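/- For a group $G$ and a normal subgroup $N$, a mixed commutator is an element $[g,w]=gwg^{-1}w^{-1}$ with $g\in G$, $w\in N$; $[G,N]$ is the subgroup generated by the mixed commutators, and for $x\in[G,N]$ let $\mathrm{cl}_{G,N}(x)$ be the least number of mixed commutators whose product is $x$ and $\mathrm{scl}_{G,N}(x)=\lim_{m\to\infty}\mathrm{cl}_{G,N}(x^m)/m$ (the limit exists). Put $\mathrm{scl}_G=\mathrm{scl}_{G,G}$ and $G'=[G,G]$. Since $\mathrm{scl}_G\le\mathrm{scl}_{G,N}$ on $[G,N]$, the two functions are bi-Lipschitz equivalent on $[G,N]$ if and only if there is $C>0$ with $\mathrm{scl}_{G,N}(x)\le C\,\mathrm{scl}_G(x)$ for all $x\in[G,N]$. **Theorem.** Let $\ell\ge 2$ and let $\Sigma_\ell$ be a closed connected oriented surface of genus $\ell$, that is, a space homeomorphic to the $4\ell$-gon with its sides identified according to the boundary word $a_1b_1a_1^{-1}b_1^{-1}\cdots a_\ell b_\ell a_\ell^{-1}b_\ell^{-1}$. Let $G_\ell=\pi_1(\Sigma_\ell)$ (with any base point). Then $\mathrm{scl}_{G_\ell}$ and $\mathrm{scl}_{G_\ell,G_\ell'}$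 are not bi-Lipschitz equivalent on $[G_\ell,G_\ell']$. More precisely, take the image of the vertices of the polygon as base point, let $a_1,b_1,\dots,a_\ell,b_\ell\in G_\ell$ be the standard generators given by the edges, so that $[a_1,b_1]\cdots[a_\ell,b_\ell]=1$, and set $$y_i=(b_ia_i^2)\,b_i^{-1}\,(b_ia_i^2)^{-1},\qquad z_i=(b_ia_i^2)\,a_i^{-\ell}\,(b_ia_i^2)^{-1},\qquad x_n=[y_1^n,z_1]\cdots[y_\ell^n,z_\ell].$$ Then $x_n\in[G_\ell,G_\ell']$ for all $n\ge 0$, $\sup_n\mathrm{scl}_{G_\ell}(x_n)<\infty$, and $\lim_{n\to\infty}\mathrm{scl}_{G_\ell,G_\ell'}(x_n)=\infty$. -/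

import Mathlib

namespace SurfaceScl

noncomputable section

open Filter Topology
open scoped commutatorElement

/-! ### Mixed commutators, (stable) mixed commutator length -/

/-- `x` is a mixed commutator `⁅g, w⁆ = g * w * g⁻¹ * w⁻¹` with `g ∈ G` and `w ∈ N`. -/
def IsMixedCommutator {G : Type*} [Group G] (N : Subgroup G) (x : G) : Prop :=
  ∃ g : G, ∃ w ∈ N, x = ⁅g, w⁆

/-- The mixed commutator length `cl_{G,N}(x)`: the least number of mixed commutators whose product
is `x`. It is meaningful for `x` in the mixed commutator subgroup `⁅⊤, N⁆ = [G, N]`, where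
such an expression exists (`exists_mixedCommutator_factorization`). -/
def mixedCl {G : Type*} [Group G] (N : Subgroup G) (x : G) : ℕ :=
  sInf {k : ℕ | ∃ L : List G, L.length = k ∧ (∀ c ∈ L, IsMixedCommutator N c) ∧ L.prod = x}

/-- The stable mixed commutator length `scl_{G,N}(x) = lim_m cl_{G,N}(x ^ m) / m`
for `x ∈ [G, N]`; the limit exists by `tendsto_mixedScl`. -/
def mixedScl {G : Type*} [Group G] (N : Subgroup G) (x : G) : ℝ :=
  limUnder atTop fun m : ℕ => (mixedCl N (x ^ m) : ℝ) / m

/-- The stable commutator length `scl_G = scl_{G,G}` for `x` in the commutator subgroup `[G, G]`. -/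
abbrev scl {G : Type*} [Group G] (x : G) : ℝ := mixedScl (⊤ : Subgroup G) x

/-- `scl_G` and `scl_{G,N}` are (bi-Lipschitzly) equivalent on `[G, N]`. Only this inequality is
required, since `scl_G ≤ scl_{G,N}` always holds on `[G, N]`. -/
def SclEquivalent {G : Type*} [Group G] (N : Subgroup G) : Prop :=
  ∃ C : ℝ, 0 < C ∧ ∀ x ∈ ⁅(⊤ : Subgroup G), N⁆, mixedScl N x ≤ C * scl x

theorem IsMixedCommutator.inv {G : Type*} [Group G] {N : Subgroup G} {x : G}
    (hx : IsMixedCommutator N x) : IsMixedCommutator N x⁻¹ := by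
  obtain ⟨g, w, hw, rfl⟩ := hx
  refine ⟨w * g * w⁻¹, w⁻¹, N.inv_mem hw, ?_⟩
  simp only [commutatorElement_def]
  group

theorem exists_mixedCommutator_factorization {G : Type*} [Group G] {N : Subgroup G} {x : G}
    (hx : x ∈ ⁅(⊤ : Subgroup G), N⁆) :
    ∃ L : List G, (∀ c ∈ L, IsMixedCommutator N c) ∧ L.prod = x := by
  rw [Subgroup.commutator_def] at hx
  induction hx using Subgroup.closure_induction with
  | mem y hy =>
    obtain ⟨g, -, w, hw, rfl⟩ := hy
    exact ⟨[⁅g, w⁆], by simpa using ⟨g, w, hw, rfl⟩, by simp⟩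
  | one => exact ⟨[], by simp, rfl⟩
  | mul y z _ _ hy hz =>
    obtain ⟨L, hL, rfl⟩ := hy
    obtain ⟨M, hM, rfl⟩ := hz
    refine ⟨L ++ M, fun c hc => ?_, by simp⟩
    rcases List.mem_append.1 hc with h | h
    exacts [hL c h, hM c h]
  | inv y _ hy =>
    obtain ⟨L, hL, rfl⟩ := hy
    refine ⟨(L.map fun c => c⁻¹).reverse, fun c hc => ?_, (List.prod_inv_reverse L).symm⟩
    obtain ⟨d, hd, rfl⟩ := List.mem_map.1 (List.mem_reverse.1 hc)
    exact (hL d hd).inv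

theorem mixedCl_mul_le {G : Type*} [Group G] {N : Subgroup G} {x y : G}
    (hx : x ∈ ⁅(⊤ : Subgroup G), N⁆) (hy : y ∈ ⁅(⊤ : Subgroup G), N⁆) :
    mixedCl N (x * y) ≤ mixedCl N x + mixedCl N y := by
  have key : ∀ {z : G}, z ∈ ⁅(⊤ : Subgroup G), N⁆ →
      ∃ L : List G, L.length = mixedCl N z ∧ (∀ c ∈ L, IsMixedCommutator N c) ∧ L.prod = z := by
    intro z hz
    obtain ⟨L, hL, hp⟩ := exists_mixedCommutator_factorization hz
    exact Nat.sInf_mem (s := {k : ℕ | ∃ L : List G, L.length = k ∧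
      (∀ c ∈ L, IsMixedCommutator N c) ∧ L.prod = z}) ⟨L.length, L, rfl, hL, hp⟩
  obtain ⟨L, hl, hL, hp⟩ := key hx
  obtain ⟨M, hm, hM, hq⟩ := key hy
  refine Nat.sInf_le ⟨L ++ M, by simp [hl, hm], ?_, by simp [hp, hq]⟩
  intro c hc
  rcases List.mem_append.1 hc with h | h
  exacts [hL c h, hM c h]

/-- Fekete's lemma: the limit defining `scl_{G,N}` exists on `[G, N]`. -/
theorem tendsto_mixedScl {G : Type*} [Group G] {N : Subgroup G} {x : G}
    (hx : x ∈ ⁅(⊤ : Subgroup G), N⁆) :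
    Tendsto (fun m : ℕ => (mixedCl N (x ^ m) : ℝ) / m) atTop (𝓝 (mixedScl N x)) := by
  have hsub : Subadditive fun m : ℕ => (mixedCl N (x ^ m) : ℝ) := by
    intro m n
    simp only [pow_add]
    exact_mod_cast mixedCl_mul_le (pow_mem hx m) (pow_mem hx n)
  exact tendsto_nhds_limUnder ⟨_, hsub.tendsto_lim ⟨0, by rintro _ ⟨m, rfl⟩; positivity⟩⟩

/-! ### The closed oriented surface of genus `ℓ` -/

/-- The closed unit disc, regarded as a polygon with `4 * ℓ` boundary edges. -/
abbrev Disc : Type := Metric.closedBall (0 : ℂ) 1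

/-- The point at parameter `t ∈ [0, 1]` on the `k`-th of the `4 * ℓ` boundary arcs of the disc,
i.e. the point `exp (2πi (k + t) / 4ℓ)`; arcs are traversed counterclockwise. -/
def arc (ℓ k : ℕ) (t : ℝ) : Disc :=
  ⟨Complex.exp (((2 * Real.pi * ((k + t) / (4 * ℓ)) : ℝ) : ℂ) * Complex.I), by
    rw [mem_closedBall_zero_iff, Complex.norm_exp_ofReal_mul_I]⟩

/-- The side pairing of the `4ℓ`-gon whose boundary word, read counterclockwise, is
`a₁ b₁ a₁⁻¹ b₁⁻¹ ⋯ a_ℓ b_ℓ a_ℓ⁻¹ b_ℓ⁻¹`. -/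
inductive SidePairing (ℓ : ℕ) : Disc → Disc → Prop
  | a (i : Fin ℓ) (t : unitInterval) :
      SidePairing ℓ (arc ℓ (4 * i) t) (arc ℓ (4 * i + 2) (1 - t))
  | b (i : Fin ℓ) (t : unitInterval) :
      SidePairing ℓ (arc ℓ (4 * i + 1) t) (arc ℓ (4 * i + 3) (1 - t))

/-- The standard closed oriented surface `Σ_ℓ` of genus `ℓ ≥ 1`: the `4ℓ`-gon with its sides
identified by the side pairing, with the quotient topology. -/
def Surface (ℓ : ℕ) : Type := Quot (SidePairing ℓ)

instance (ℓ : ℕ) : TopologicalSpace (Surface ℓ) :=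
  inferInstanceAs (TopologicalSpace (Quot (SidePairing ℓ)))

/-- The projection from the disc to the surface. -/
def toSurface (ℓ : ℕ) (z : Disc) : Surface ℓ := Quot.mk _ z

theorem continuous_toSurface (ℓ : ℕ) : Continuous (toSurface ℓ) := continuous_quot_mk

theorem continuous_arc (ℓ k : ℕ) : Continuous (arc ℓ k) := by
  unfold arc
  fun_prop

theorem arc_one (ℓ k : ℕ) : arc ℓ k 1 = arc ℓ (k + 1) 0 := by
  simp [arc]

/-- The base point: the common image of all vertices of the polygon. -/
def vertex (ℓ : ℕ) : Surface ℓ := toSurface ℓ (arc ℓ 0 0)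

theorem toSurface_a (ℓ : ℕ) (i : Fin ℓ) (t : unitInterval) :
    toSurface ℓ (arc ℓ (4 * i) t) = toSurface ℓ (arc ℓ (4 * i + 2) (1 - t)) :=
  Quot.sound (SidePairing.a i t)

theorem toSurface_b (ℓ : ℕ) (i : Fin ℓ) (t : unitInterval) :
    toSurface ℓ (arc ℓ (4 * i + 1) t) = toSurface ℓ (arc ℓ (4 * i + 3) (1 - t)) :=
  Quot.sound (SidePairing.b i t)

theorem toSurface_corners (ℓ : ℕ) (i : Fin ℓ) :
    toSurface ℓ (arc ℓ (4 * i + 3) 0) = toSurface ℓ (arc ℓ (4 * i) 0) ∧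
    toSurface ℓ (arc ℓ (4 * i + 2) 0) = toSurface ℓ (arc ℓ (4 * i) 0) ∧
    toSurface ℓ (arc ℓ (4 * i + 1) 0) = toSurface ℓ (arc ℓ (4 * i) 0) ∧
    toSurface ℓ (arc ℓ (4 * (i + 1)) 0) = toSurface ℓ (arc ℓ (4 * i) 0) := by
  have a0 := toSurface_a ℓ i 0
  have a1 := toSurface_a ℓ i 1
  have b0 := toSurface_b ℓ i 0
  have b1 := toSurface_b ℓ i 1
  simp only [Set.Icc.coe_zero, Set.Icc.coe_one, sub_zero, sub_self, arc_one, add_assoc,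
    Nat.reduceAdd] at a0 a1 b0 b1
  rw [mul_add, mul_one]
  exact ⟨a0.symm, by rw [b1, a0], by rw [a1, b1, a0], by rw [← b0, a1, b1, a0]⟩

theorem toSurface_arc_zero (ℓ : ℕ) (i : ℕ) (hi : i ≤ ℓ) :
    toSurface ℓ (arc ℓ (4 * i) 0) = vertex ℓ := by
  induction i with
  | zero => rfl
  | succ j ih =>
    rw [← ih (by omega)]
    exact (toSurface_corners ℓ ⟨j, hi⟩).2.2.2

/-- The loop in the surface given by the edge `aᵢ` of the polygon. -/
def edgeA (ℓ : ℕ) (i : Fin ℓ) : Path (vertex ℓ) (vertex ℓ) where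
  toFun t := toSurface ℓ (arc ℓ (4 * i) t)
  continuous_toFun := (continuous_toSurface ℓ).comp
    ((continuous_arc ℓ _).comp continuous_subtype_val)
  source' := by simpa using toSurface_arc_zero ℓ i i.2.le
  target' := by
    simp only [Set.Icc.coe_one, arc_one]
    rw [(toSurface_corners ℓ i).2.2.1, toSurface_arc_zero ℓ i i.2.le]

/-- The loop in the surface given by the edge `bᵢ` of the polygon. -/
def edgeB (ℓ : ℕ) (i : Fin ℓ) : Path (vertex ℓ) (vertex ℓ) where
  toFun t := toSurface ℓ (arc ℓ (4 * i + 1) t)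
  continuous_toFun := (continuous_toSurface ℓ).comp
    ((continuous_arc ℓ _).comp continuous_subtype_val)
  source' := by
    simp only [Set.Icc.coe_zero]
    rw [(toSurface_corners ℓ i).2.2.1, toSurface_arc_zero ℓ i i.2.le]
  target' := by
    simp only [Set.Icc.coe_one, arc_one, add_assoc, Nat.reduceAdd]
    rw [(toSurface_corners ℓ i).2.1, toSurface_arc_zero ℓ i i.2.le]

/-- The standard generator `aᵢ` of `π₁(Σ_ℓ)`. In Mathlib's fundamental group `p * q` is the loop
`q` followed by `p`, which is opposite to the usual convention; inversion identifies the two groups,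
so the generator is the inverse of the edge loop. With this choice the relation
`⁅a₁, b₁⁆ * ⋯ * ⁅a_ℓ, b_ℓ⁆ = 1` holds in the written order. -/
def genA (ℓ : ℕ) (i : Fin ℓ) : FundamentalGroup (Surface ℓ) (vertex ℓ) :=
  (FundamentalGroup.fromPath (Path.Homotopic.Quotient.mk (edgeA ℓ i)))⁻¹

/-- The standard generator `bᵢ` of `π₁(Σ_ℓ)`; see `genA` for the convention. -/
def genB (ℓ : ℕ) (i : Fin ℓ) : FundamentalGroup (Surface ℓ) (vertex ℓ) :=
  (FundamentalGroup.fromPath (Path.Homotopic.Quotient.mk (edgeB ℓ i)))⁻¹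

/-! ### The witnessing sequence -/

/-- `y = (b a²) b⁻¹ (b a²)⁻¹`. -/
def elemY {G : Type*} [Group G] (a b : G) : G :=
  (b * a ^ 2) * b⁻¹ * (b * a ^ 2)⁻¹

/-- `z = (b a²) a^{-ℓ} (b a²)⁻¹`. -/
def elemZ {G : Type*} [Group G] (ℓ : ℕ) (a b : G) : G :=
  (b * a ^ 2) * (a ^ ℓ)⁻¹ * (b * a ^ 2)⁻¹

/-- `x_n = ⁅y₁ ^ n, z₁⁆ * ⋯ * ⁅y_ℓ ^ n, z_ℓ⁆`, where `yᵢ` and `zᵢ` are built from `aᵢ` and `bᵢ`. -/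
def witness {G : Type*} [Group G] {ℓ : ℕ} (a b : Fin ℓ → G) (n : ℕ) : G :=
  (List.ofFn fun i : Fin ℓ => ⁅elemY (a i) (b i) ^ n, elemZ ℓ (a i) (b i)⁆).prod

/-- The `n`-th witness in `π₁(X, e(v))`, for a homeomorphism `e` from the standard surface to `X`;
the generators are the images under `e` of the standard generators of `π₁(Σ_ℓ, v)`. -/
def surfaceWitness {ℓ : ℕ} {X : Type*} [TopologicalSpace X] (e : Surface ℓ ≃ₜ X) (n : ℕ) :
    FundamentalGroup X (e (vertex ℓ)) :=
  witness (fun i => FundamentalGroup.map (e : C(Surface ℓ, X)) (vertex ℓ) (genA ℓ i))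
    (fun i => FundamentalGroup.map (e : C(Surface ℓ, X)) (vertex ℓ) (genB ℓ i)) n

end

end SurfaceScl

/-!
A homogeneous quasimorphism on `G'` that is invariant under conjugation by `G` bounds `scl_{G,G'}`
from below (the easy half of Bavard duality), so it suffices to find one that is unbounded on the
`x_n`, while `scl_G (x_n) ≤ ℓ` because `x_n` is a product of `ℓ` commutators.

Suppose `⁅a₁, b₁⁆ ⋯ ⁅a_ℓ, b_ℓ⁆ = c⁻¹` in a group `C`, with `c` central. In the twisted product of
`C` with `ℤ × ℤ`, two integer coordinates per generator are enough to absorb the defect `c`, so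
that `π₁(Σ_ℓ)` maps to it. Commutators land in `C`, and a homogeneous quasimorphism `f` of `C` pulls
back to one on `G'`. The base component of `x_n` is `c ^ (-nℓ)` times a product of `ℓ` commutators
of `C`, hence `f` is unbounded on the `x_n` if `f c ≠ 0`.

Here `C` is the group of lifts of circle homeomorphisms and `f` is the translation number. Lifts
`a`, `b` of two Blaschke factors with a common parameter satisfying `r⁴ + 2 r² = 1` have a
commutator which covers an involution of the circle and does not fix `0`, so that its square
is a nontrivial integer translation; this uses two of the `ℓ` handles.

Homomorphisms out of `π₁(Σ_ℓ)` are obtained from coverings: elements of a group `Q` that satisfy the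
surface relation tell how to glue copies of the polygon, one for each element of `Q`, to a covering
of `Σ_ℓ` with deck group `Q`, and the homomorphism is the monodromy.
-/

namespace SurfaceScl

noncomputable section

open Filter Topology
open scoped commutatorElement

/-! ### Mixed commutator length under homomorphisms -/

section MixedCl

variable {G H : Type*} [Group G] [Group H] {N : Subgroup G} {M : Subgroup H} {x : G}

theorem IsMixedCommutator.mem (hx : IsMixedCommutator N x) : x ∈ ⁅(⊤ : Subgroup G), N⁆ := by
  obtain ⟨g, w, hw, rfl⟩ := hx
  exact Subgroup.commutator_mem_commutator (Subgroup.mem_top g) hw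

theorem IsMixedCommutator.map {φ : G →* H} (hφ : N ≤ M.comap φ) (hx : IsMixedCommutator N x) :
    IsMixedCommutator M (φ x) := by
  obtain ⟨g, w, hw, rfl⟩ := hx
  exact ⟨φ g, φ w, hφ hw, map_commutatorElement φ g w⟩

theorem mixedCl_prod_le_length {L : List G} (hL : ∀ c ∈ L, IsMixedCommutator N c) :
    mixedCl N L.prod ≤ L.length :=
  Nat.sInf_le ⟨L, rfl, hL, rfl⟩

theorem exists_list_length_eq_mixedCl (hx : x ∈ ⁅(⊤ : Subgroup G), N⁆) :
    ∃ L : List G, L.length = mixedCl N x ∧ (∀ c ∈ L, IsMixedCommutator N c) ∧ L.prod = x := by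
  obtain ⟨L, hL, hLx⟩ := exists_mixedCommutator_factorization hx
  exact Nat.sInf_mem (s := {k : ℕ | ∃ L : List G, L.length = k ∧
    (∀ c ∈ L, IsMixedCommutator N c) ∧ L.prod = x}) ⟨L.length, L, rfl, hL, hLx⟩

theorem mixedCl_pow_le (hx : x ∈ ⁅(⊤ : Subgroup G), N⁆) (m : ℕ) :
    mixedCl N (x ^ m) ≤ m * mixedCl N x := by
  induction m with
  | zero => simpa using mixedCl_prod_le_length (N := N) (L := []) (by simp)
  | succ m ih =>
    rw [pow_succ, add_mul, one_mul]
    exact (mixedCl_mul_le (pow_mem hx m) hx).trans (by gcongr)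

theorem mixedCl_map_le (φ : G →* H) (hφ : N ≤ M.comap φ) (hx : x ∈ ⁅(⊤ : Subgroup G), N⁆) :
    mixedCl M (φ x) ≤ mixedCl N x := by
  obtain ⟨L, hlen, hL, rfl⟩ := exists_list_length_eq_mixedCl hx
  rw [← hlen, map_list_prod, ← List.length_map φ]
  exact mixedCl_prod_le_length (List.forall_mem_map.2 fun c hc => (hL c hc).map hφ)

theorem mixedScl_le_mixedCl (hx : x ∈ ⁅(⊤ : Subgroup G), N⁆) : mixedScl N x ≤ mixedCl N x := by
  refine le_of_tendsto (tendsto_mixedScl hx) ?_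
  filter_upwards [eventually_gt_atTop 0] with m hm
  rw [div_le_iff₀ (by exact_mod_cast hm), mul_comm]
  exact_mod_cast mixedCl_pow_le hx m

theorem map_mem_commutator_top (φ : G →* H) (hφ : N ≤ M.comap φ)
    (hx : x ∈ ⁅(⊤ : Subgroup G), N⁆) : φ x ∈ ⁅(⊤ : Subgroup H), M⁆ := by
  have hmap := Subgroup.mem_map_of_mem φ hx
  rw [Subgroup.map_commutator] at hmap
  exact Subgroup.commutator_mono le_top (Subgroup.map_le_iff_le_comap.2 hφ) hmap

theorem mixedScl_map_le (φ : G →* H) (hφ : N ≤ M.comap φ) (hx : x ∈ ⁅(⊤ : Subgroup G), N⁆) :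
    mixedScl M (φ x) ≤ mixedScl N x := by
  refine le_of_tendsto_of_tendsto' (tendsto_mixedScl (map_mem_commutator_top φ hφ hx))
    (tendsto_mixedScl hx) fun m => ?_
  rw [← map_pow]
  gcongr
  exact mixedCl_map_le φ hφ (pow_mem hx m)

theorem commutator_le_comap (φ : G →* H) : commutator G ≤ (commutator H).comap φ := fun _ hx =>
  map_mem_commutator_top φ le_top hx

theorem SclEquivalent.of_mulEquiv (e : G ≃* H) (h : SclEquivalent (commutator H)) :
    SclEquivalent (commutator G) := by
  obtain ⟨C, hC, h⟩ := h
  refine ⟨C, hC, fun x hx => ?_⟩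
  have hex : e x ∈ ⁅(⊤ : Subgroup H), commutator H⁆ :=
    map_mem_commutator_top (e : G →* H) (commutator_le_comap _) hx
  calc mixedScl (commutator G) x = mixedScl (commutator G) (e.symm (e x)) := by
        rw [e.symm_apply_apply]
    _ ≤ mixedScl (commutator H) (e x) :=
      mixedScl_map_le (e.symm : H →* G) (commutator_le_comap _) hex
    _ ≤ C * scl (e x) := h (e x) hex
    _ ≤ C * scl x := mul_le_mul_of_nonneg_left (mixedScl_map_le (e : G →* H) le_top
      (Subgroup.commutator_mono le_rfl le_top hx)) hC.le

theorem not_sclEquivalent_of_tendsto {u : ℕ → G} (hu : ∀ n, u n ∈ ⁅(⊤ : Subgroup G), N⁆)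
    (hbdd : BddAbove (Set.range fun n => scl (u n)))
    (hlim : Tendsto (fun n => mixedScl N (u n)) atTop atTop) : ¬ SclEquivalent N := by
  rintro ⟨C, hC, h⟩
  obtain ⟨K, hK⟩ := hbdd
  obtain ⟨n, hn⟩ := (hlim.eventually_gt_atTop (C * K)).exists
  have hscl : scl (u n) ≤ K := hK ⟨n, rfl⟩
  exact hn.not_ge ((h _ (hu n)).trans (by gcongr))

end MixedCl

/-! ### Invariant quasimorphisms -/

/-- `μ` restricts to a homogeneous quasimorphism of defect at most `D` on the subgroup `N`, and is
invariant there under conjugation by the whole group. For `N = ⊤` these are the homogeneous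
quasimorphisms of `G`. -/
structure IsInvariantQuasimorphismOn {G : Type*} [Group G] (N : Subgroup G) (μ : G → ℝ) (D : ℝ) :
    Prop where
  abs_map_mul_sub_sub_le : ∀ x ∈ N, ∀ y ∈ N, |μ (x * y) - μ x - μ y| ≤ D
  map_zpow : ∀ x ∈ N, ∀ n : ℤ, μ (x ^ n) = n * μ x
  map_conj : ∀ g, ∀ x ∈ N, μ (g * x * g⁻¹) = μ x

namespace IsInvariantQuasimorphismOn

variable {G : Type*} [Group G] {N : Subgroup G} {μ : G → ℝ} {D : ℝ} {x : G}

theorem map_one (hμ : IsInvariantQuasimorphismOn N μ D) : μ 1 = 0 := by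
  simpa using hμ.map_zpow 1 N.one_mem 0

theorem map_pow (hμ : IsInvariantQuasimorphismOn N μ D) (hx : x ∈ N) (n : ℕ) :
    μ (x ^ n) = n * μ x := by
  simpa using hμ.map_zpow x hx n

theorem map_inv (hμ : IsInvariantQuasimorphismOn N μ D) (hx : x ∈ N) : μ x⁻¹ = -μ x := by
  simpa using hμ.map_zpow x hx (-1)

variable [N.Normal]

theorem abs_map_le_of_isMixedCommutator (hμ : IsInvariantQuasimorphismOn N μ D)
    (hx : IsMixedCommutator N x) : |μ x| ≤ D := by
  obtain ⟨g, w, hw, rfl⟩ := hx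
  have h := hμ.abs_map_mul_sub_sub_le _ (Subgroup.Normal.conj_mem ‹_› w hw g) _ (N.inv_mem hw)
  rwa [hμ.map_conj g w hw, hμ.map_inv hw, sub_neg_eq_add, sub_add_cancel] at h

theorem abs_map_list_prod_le (hμ : IsInvariantQuasimorphismOn N μ D) (L : List G)
    (hL : ∀ c ∈ L, IsMixedCommutator N c) : |μ L.prod| ≤ 2 * D * L.length := by
  induction L with
  | nil => simp [hμ.map_one]
  | cons c L ih =>
    obtain ⟨hc, hL⟩ := List.forall_mem_cons.1 hL
    have hmem {d : G} (hd : IsMixedCommutator N d) : d ∈ N :=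
      Subgroup.commutator_le_right _ _ hd.mem
    have hdefect := hμ.abs_map_mul_sub_sub_le c (hmem hc) L.prod
      (N.list_prod_mem fun d hd => hmem (hL d hd))
    have hhead := hμ.abs_map_le_of_isMixedCommutator hc
    have htail := ih hL
    rw [List.prod_cons, List.length_cons]
    push_cast
    rw [abs_le] at *
    constructor <;> linarith

/-- The easy half of Bavard duality. -/
theorem abs_map_le_mixedScl (hμ : IsInvariantQuasimorphismOn N μ D)
    (hx : x ∈ ⁅(⊤ : Subgroup G), N⁆) : |μ x| ≤ 2 * D * mixedScl N x := by
  have hcl (m : ℕ) : m * |μ x| ≤ 2 * D * mixedCl N (x ^ m) := by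
    obtain ⟨L, hlen, hL, hLx⟩ := exists_list_length_eq_mixedCl (pow_mem hx m)
    rw [← hlen, ← Nat.abs_cast m, ← abs_mul, ← hμ.map_pow (Subgroup.commutator_le_right _ _ hx),
      ← hLx]
    exact hμ.abs_map_list_prod_le L hL
  refine ge_of_tendsto ((tendsto_mixedScl hx).const_mul (2 * D)) ?_
  filter_upwards [eventually_gt_atTop 0] with m hm
  rw [mul_div, le_div_iff₀ (by exact_mod_cast hm), mul_comm]
  exact hcl m

end IsInvariantQuasimorphismOn

/-! ### The witnesses lie in `[G, G']` and have bounded `scl_G` -/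

section Witness

variable {G H : Type*} [Group G] [Group H] {ℓ : ℕ}

theorem map_prod_ofFn_commutator (φ : G →* H) (a b : Fin ℓ → G) :
    φ (List.ofFn fun i => ⁅a i, b i⁆).prod = (List.ofFn fun i => ⁅φ (a i), φ (b i)⁆).prod := by
  simp only [map_list_prod, List.map_ofFn, Function.comp_def, map_commutatorElement]

theorem map_elemY (φ : G →* H) (a b : G) : φ (elemY a b) = elemY (φ a) (φ b) := by
  simp only [elemY, map_mul, map_pow, map_inv]

theorem map_elemZ (φ : G →* H) (a b : G) : φ (elemZ ℓ a b) = elemZ ℓ (φ a) (φ b) := by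
  simp only [elemZ, map_mul, map_pow, map_inv]

theorem map_witness (φ : G →* H) (a b : Fin ℓ → G) (n : ℕ) :
    φ (witness a b n) = witness (fun i => φ (a i)) (fun i => φ (b i)) n := by
  simp only [witness, map_prod_ofFn_commutator, map_pow, map_elemY, map_elemZ]

theorem forall_mem_ofFn_isMixedCommutator_top (a b : Fin ℓ → G) :
    ∀ c ∈ List.ofFn fun i => ⁅a i, b i⁆, IsMixedCommutator (⊤ : Subgroup G) c :=
  List.forall_mem_ofFn_iff.2 fun i => ⟨a i, b i, Subgroup.mem_top _, rfl⟩

theorem scl_witness_le (a b : Fin ℓ → G) (n : ℕ) : scl (witness a b n) ≤ ℓ := by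
  have hcomm := forall_mem_ofFn_isMixedCommutator_top (fun i => elemY (a i) (b i) ^ n)
    fun i => elemZ ℓ (a i) (b i)
  have hcl : mixedCl ⊤ (witness a b n) ≤ ℓ := by
    simpa only [witness, List.length_ofFn] using mixedCl_prod_le_length hcomm
  exact (mixedScl_le_mixedCl (Subgroup.list_prod_mem _ fun c hc => (hcomm c hc).mem)).trans
    (by exact_mod_cast hcl)

theorem prod_ofFn_zpow_of_mem_center {m : ℕ} {f : Fin m → G} (hf : ∀ i, f i ∈ Subgroup.center G)
    (k : ℤ) : (List.ofFn fun i => f i ^ k).prod = (List.ofFn f).prod ^ k := by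
  induction m with
  | zero => simp
  | succ m ih =>
    have hcomm : Commute (f 0) (List.ofFn fun i : Fin m => f i.succ).prod :=
      (Subgroup.mem_center_iff.1 (hf 0) _).symm
    rw [List.ofFn_succ, List.prod_cons, List.ofFn_succ, List.prod_cons,
      ih fun i => hf i.succ, hcomm.mul_zpow]

section CentralCommutators

variable (h : commutator G ≤ Subgroup.center G)
include h

theorem commutatorElement_mem_center (x y : G) : ⁅x, y⁆ ∈ Subgroup.center G :=
  h (Subgroup.commutator_mem_commutator (Subgroup.mem_top x) (Subgroup.mem_top y))

theorem conj_commutatorElement_eq (g x y : G) : g * ⁅x, y⁆ * g⁻¹ = ⁅x, y⁆ := by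
  rw [Subgroup.mem_center_iff.1 (commutatorElement_mem_center h x y) g, mul_inv_cancel_right]

theorem commutatorElement_inv_left_eq (x y : G) : ⁅x⁻¹, y⁆ = ⁅y, x⁆ := by
  simpa only [commutatorElement_inv_left, inv_inv] using conj_commutatorElement_eq h x⁻¹ y x

theorem commutatorElement_pow_left (x y : G) (m : ℕ) : ⁅x ^ m, y⁆ = ⁅x, y⁆ ^ m := by
  induction m with
  | zero => simp
  | succ m ih =>
    rw [pow_succ', commutatorElement_mul_left_eq_conj_mul, conj_commutatorElement_eq h, ih,
      pow_succ]

theorem commutatorElement_pow_right (x y : G) (m : ℕ) : ⁅x, y ^ m⁆ = ⁅x, y⁆ ^ m := by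
  rw [← commutatorElement_inv, commutatorElement_pow_left h, ← inv_pow, commutatorElement_inv]

theorem commutator_elemY_pow_elemZ (a b : G) (n : ℕ) :
    ⁅elemY a b ^ n, elemZ ℓ a b⁆ = ⁅a, b⁆ ^ (-(n * ℓ : ℤ)) := by
  have hinv : ⁅b⁻¹, a⁻¹⁆ = ⁅a, b⁆⁻¹ := by
    rw [commutatorElement_inv_left_eq h, commutatorElement_inv_left_eq h, commutatorElement_inv]
  rw [elemY, elemZ, conj_pow, ← conjugate_commutatorElement, conj_commutatorElement_eq h,
    ← inv_pow, commutatorElement_pow_left h, commutatorElement_pow_right h, hinv, ← pow_mul,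
    inv_pow, mul_comm, zpow_neg]
  norm_cast

theorem witness_eq_one (a b : Fin ℓ → G) (hab : (List.ofFn fun i => ⁅a i, b i⁆).prod = 1) (n : ℕ) :
    witness a b n = 1 := by
  simp only [witness, commutator_elemY_pow_elemZ h]
  rw [prod_ofFn_zpow_of_mem_center fun i => commutatorElement_mem_center h _ _, hab, one_zpow]

end CentralCommutators

theorem commutator_le_center_of_surjective {φ : G →* H} (hφ : Function.Surjective φ)
    (hker : ⁅(⊤ : Subgroup G), commutator G⁆ ≤ φ.ker) : commutator H ≤ Subgroup.center H := by
  rwa [← Subgroup.commutator_top_left_eq_bot_iff_le_center, commutator_def,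
    ← Subgroup.map_top_of_surjective φ hφ, ← Subgroup.map_commutator, ← Subgroup.map_commutator,
    Subgroup.map_eq_bot_iff]

theorem witness_mem {a b : Fin ℓ → G} (hab : (List.ofFn fun i => ⁅a i, b i⁆).prod = 1) (n : ℕ) :
    witness a b n ∈ ⁅(⊤ : Subgroup G), commutator G⁆ := by
  have hker := QuotientGroup.ker_mk' ⁅(⊤ : Subgroup G), commutator G⁆
  rw [← hker, MonoidHom.mem_ker, map_witness]
  exact witness_eq_one
    (commutator_le_center_of_surjective (QuotientGroup.mk'_surjective _) hker.ge) _ _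
    (by rw [← map_prod_ofFn_commutator, hab, map_one]) n

end Witness

/-! ### A twisted product with `ℤ × ℤ` -/

/-- The product `C × ℤ × ℤ` with multiplication
`(x, m, n) (x', m', n') = (x x' c ^ (m n'), m + m', n + n')`, where `c` is central in `C`. It is the
central product of `C` with the integral Heisenberg group over `c`, and serves to absorb a central
defect `c` of a product of commutators. -/
@[ext]
structure Twisted (C : Type*) [Group C] (c : Subgroup.center C) where
  /-- The component in the base group. -/
  base : C
  /-- The first integer coordinate. -/
  fst : ℤ
  /-- The second integer coordinate. -/
  snd : ℤ

namespace Twisted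

variable {C : Type*} [Group C] {c : Subgroup.center C}

theorem commute_zpow (k : ℤ) (x : C) : Commute ((c : C) ^ k) x :=
  Commute.zpow_left (Subgroup.mem_center_iff.1 c.2 x).symm k

instance : Mul (Twisted C c) :=
  ⟨fun p q => ⟨p.base * q.base * (c : C) ^ (p.fst * q.snd), p.fst + q.fst, p.snd + q.snd⟩⟩

instance : One (Twisted C c) := ⟨⟨1, 0, 0⟩⟩

instance : Inv (Twisted C c) :=
  ⟨fun p => ⟨p.base⁻¹ * (c : C) ^ (p.fst * p.snd), -p.fst, -p.snd⟩⟩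

theorem base_mul (p q : Twisted C c) :
    (p * q).base = p.base * q.base * (c : C) ^ (p.fst * q.snd) := rfl

@[simp] theorem fst_mul (p q : Twisted C c) : (p * q).fst = p.fst + q.fst := rfl

@[simp] theorem snd_mul (p q : Twisted C c) : (p * q).snd = p.snd + q.snd := rfl

@[simp] theorem base_one : (1 : Twisted C c).base = 1 := rfl

@[simp] theorem fst_one : (1 : Twisted C c).fst = 0 := rfl

@[simp] theorem snd_one : (1 : Twisted C c).snd = 0 := rfl

theorem base_inv (p : Twisted C c) : p⁻¹.base = p.base⁻¹ * (c : C) ^ (p.fst * p.snd) := rfl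

@[simp] theorem fst_inv (p : Twisted C c) : p⁻¹.fst = -p.fst := rfl

@[simp] theorem snd_inv (p : Twisted C c) : p⁻¹.snd = -p.snd := rfl

instance : Group (Twisted C c) :=
  Group.ofLeftAxioms
    (fun p q r => by
      ext
      · simp only [base_mul, fst_mul, snd_mul]
        rw [mul_assoc (p.base * q.base), (commute_zpow _ r.base).eq]
        simp only [mul_assoc, ← zpow_add]
        congr 4
        ring
      · simp [add_assoc]
      · simp [add_assoc])
    (fun p => by ext <;> simp [base_mul])
    (fun p => by
      ext
      · simp only [base_mul, base_inv, fst_inv, base_one]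
        rw [mul_assoc p.base⁻¹, (commute_zpow _ p.base).eq, mul_assoc, mul_assoc, ← zpow_add]
        simp
      · simp
      · simp)

@[simp] theorem fst_pow (p : Twisted C c) (n : ℕ) : (p ^ n).fst = n * p.fst := by
  induction n with
  | zero => simp
  | succ n ih => rw [pow_succ, fst_mul, ih]; push_cast; ring

@[simp] theorem snd_pow (p : Twisted C c) (n : ℕ) : (p ^ n).snd = n * p.snd := by
  induction n with
  | zero => simp
  | succ n ih => rw [pow_succ, snd_mul, ih]; push_cast; ring

/-- The inclusion of the base group into the twisted product. -/
def incl : C →* Twisted C c where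
  toFun x := ⟨x, 0, 0⟩
  map_one' := rfl
  map_mul' x y := by ext <;> simp [base_mul]

@[simp] theorem base_incl (x : C) : (incl x : Twisted C c).base = x := rfl

@[simp] theorem fst_incl (x : C) : (incl x : Twisted C c).fst = 0 := rfl

@[simp] theorem snd_incl (x : C) : (incl x : Twisted C c).snd = 0 := rfl

/-- The determinant of the integer coordinates of two elements: the exponent of `c` by which their
commutator differs from that of their base components. -/
def area (p q : Twisted C c) : ℤ := p.fst * q.snd - q.fst * p.snd

theorem commutator_eq (p q : Twisted C c) :
    ⁅p, q⁆ = incl (⁅p.base, q.base⁆ * (c : C) ^ area p q) := by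
  rw [commutatorElement_def, mul_assoc, ← mul_inv_rev, mul_inv_eq_iff_eq_mul]
  ext
  · simp only [base_mul, base_incl, fst_incl, zero_mul, zpow_zero, mul_one, mul_assoc]
    rw [(commute_zpow _ _).eq]
    simp only [commutatorElement_def, mul_assoc, ← zpow_add, inv_mul_cancel_left, area]
    congr 3
    ring
  · simp only [fst_mul, fst_incl, zero_add, add_comm p.fst]
  · simp only [snd_mul, snd_incl, zero_add, add_comm p.snd]

theorem prod_commutator_eq {m : ℕ} (p q : Fin m → Twisted C c) :
    (List.ofFn fun i => ⁅p i, q i⁆).prod =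
      incl ((List.ofFn fun i => ⁅(p i).base, (q i).base⁆).prod *
        (c : C) ^ ∑ i, area (p i) (q i)) := by
  induction m with
  | zero => simp
  | succ m ih =>
    rw [List.ofFn_succ, List.prod_cons, List.ofFn_succ, List.prod_cons, ih, commutator_eq,
      ← map_mul, Fin.sum_univ_succ, zpow_add, mul_assoc, mul_assoc, ← mul_assoc ((c : C) ^ _),
      (commute_zpow _ _).eq, mul_assoc]

theorem area_elemY_pow_elemZ (ℓ n : ℕ) (p q : Twisted C c) :
    area (elemY p q ^ n) (elemZ ℓ p q) = -(n * ℓ) * area p q := by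
  simp only [area, elemY, elemZ, fst_mul, snd_mul, fst_inv, snd_inv, fst_pow, snd_pow]
  ring

theorem commutator_le_range_incl : commutator (Twisted C c) ≤ (incl (c := c)).range := by
  rw [commutator_def, Subgroup.commutator_le]
  exact fun p _ q _ => ⟨_, (commutator_eq p q).symm⟩

theorem base_conj_incl (p : Twisted C c) (x : C) :
    (p * incl x * p⁻¹).base = p.base * x * p.base⁻¹ := by
  have hconj : p * incl x * p⁻¹ = ⁅p, incl x⁆ * incl x := by group
  rw [hconj, commutator_eq, ← map_mul, base_incl]
  simp [area, commutatorElement_def]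

end Twisted

section LowerBound

variable {C G : Type*} [Group C] [Group G] {c : Subgroup.center C} {f : C → ℝ} {D : ℝ}

theorem exists_map_eq_incl (φ : G →* Twisted C c) {x : G} (hx : x ∈ commutator G) :
    ∃ y, φ x = Twisted.incl y := by
  obtain ⟨y, hy⟩ := Twisted.commutator_le_range_incl (commutator_le_comap φ hx)
  exact ⟨y, hy.symm⟩

theorem IsInvariantQuasimorphismOn.comp_base (hf : IsInvariantQuasimorphismOn ⊤ f D)
    (φ : G →* Twisted C c) :
    IsInvariantQuasimorphismOn (commutator G) (fun x => f (φ x).base) D where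
  abs_map_mul_sub_sub_le x hx y hy := by
    obtain ⟨u, hu⟩ := exists_map_eq_incl φ hx
    obtain ⟨v, hv⟩ := exists_map_eq_incl φ hy
    rw [map_mul, hu, hv, ← map_mul, Twisted.base_incl, Twisted.base_incl, Twisted.base_incl]
    exact hf.abs_map_mul_sub_sub_le u trivial v trivial
  map_zpow x hx n := by
    obtain ⟨u, hu⟩ := exists_map_eq_incl φ hx
    rw [_root_.map_zpow, hu, ← _root_.map_zpow, Twisted.base_incl, Twisted.base_incl]
    exact hf.map_zpow u trivial n
  map_conj g x hx := by
    obtain ⟨u, hu⟩ := exists_map_eq_incl φ hx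
    rw [map_mul, map_mul, _root_.map_inv, hu, Twisted.base_conj_incl, Twisted.base_incl]
    exact hf.map_conj _ u trivial

theorem exists_base_witness_eq {ℓ : ℕ} (hf : IsInvariantQuasimorphismOn ⊤ f D)
    (p q : Fin ℓ → Twisted C c) (n : ℕ) : ∃ u : C, |f u| ≤ 2 * D * ℓ ∧
      (witness p q n).base = u * (c : C) ^ (-(n * ℓ) * ∑ i, Twisted.area (p i) (q i)) := by
  refine ⟨(List.ofFn fun i => ⁅(elemY (p i) (q i) ^ n).base, (elemZ ℓ (p i) (q i)).base⁆).prod,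
    ?_, ?_⟩
  · simpa only [List.length_ofFn] using
      hf.abs_map_list_prod_le _ (forall_mem_ofFn_isMixedCommutator_top _ _)
  · simp only [witness, Twisted.prod_commutator_eq, Twisted.base_incl, Finset.mul_sum,
      Twisted.area_elemY_pow_elemZ]

/-- `scl_{G,G'}` of the witnesses grows linearly, because `f` takes on them the value
`-n ℓ (∑ area) f(c)` up to a bounded error. -/
theorem tendsto_mixedScl_witness {ℓ : ℕ} (hf : IsInvariantQuasimorphismOn ⊤ f D)
    (hc : f c ≠ 0) (φ : G →* Twisted C c) {A B : Fin ℓ → G}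
    (hAB : (List.ofFn fun i => ⁅A i, B i⁆).prod = 1)
    (harea : ∑ i, Twisted.area (φ (A i)) (φ (B i)) ≠ 0) :
    Tendsto (fun n => mixedScl (commutator G) (witness A B n)) atTop atTop := by
  set k : ℤ := ∑ i, Twisted.area (φ (A i)) (φ (B i)) with hk
  have hℓ : 0 < ℓ := Nat.pos_of_ne_zero fun h => harea (by subst h; exact Finset.sum_empty)
  set K : ℝ := ℓ * |k * f c|
  have hK : 0 < K := by positivity
  have hlower (n : ℕ) :
      n * K ≤ 2 * D * mixedScl (commutator G) (witness A B n) + (2 * ℓ + 1) * D := by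
    obtain ⟨u, hu, hbase⟩ := exists_base_witness_eq hf (fun i => φ (A i)) (fun i => φ (B i)) n
    rw [← map_witness, ← hk] at hbase
    have hscl := (hf.comp_base φ).abs_map_le_mixedScl (witness_mem hAB n)
    have hdefect := hf.abs_map_mul_sub_sub_le u trivial ((c : C) ^ (-(n * ℓ) * k)) trivial
    rw [hf.map_zpow c trivial, ← hbase] at hdefect
    have hmain : n * K = |((-(n * ℓ) * k : ℤ) : ℝ) * f c| := by
      simp [K, abs_mul, mul_assoc]
    rw [hmain]
    rw [abs_le] at hscl hu hdefect
    refine abs_le.2 ⟨?_, ?_⟩ <;> linarith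
  have hD : 0 < D := by
    refine lt_of_le_of_ne ((abs_nonneg _).trans (hf.abs_map_mul_sub_sub_le 1 trivial 1 trivial)) ?_
    rintro rfl
    simpa [hK.not_ge] using hlower 1
  refine (tendsto_const_mul_atTop_of_pos (by positivity : 0 < 2 * D)).1 ?_
  refine tendsto_atTop_mono (fun n => sub_le_iff_le_add.2 (hlower n)) ?_
  exact tendsto_atTop_add_const_right _ _ (tendsto_natCast_atTop_atTop.atTop_mul_const hK)

end LowerBound

section TranslationNumber

open CircleDeg1Lift

theorem abs_translationNumber_mul_sub_sub_le (f g : CircleDeg1Lift) :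
    |translationNumber (f * g) - translationNumber f - translationNumber g| ≤ 4 := by
  have hf := dist_map_zero_translationNumber_le f
  have hg := dist_map_zero_translationNumber_le g
  have hfg := dist_map_zero_translationNumber_le (f * g)
  have hmap := (dist_map_map_zero_lt f g).le
  rw [mul_apply] at hfg
  simp only [Real.dist_eq, abs_le] at *
  constructor <;> linarith

theorem isInvariantQuasimorphismOn_translationNumber :
    IsInvariantQuasimorphismOn (⊤ : Subgroup CircleDeg1Liftˣ)
      (fun f => translationNumber (f : CircleDeg1Lift)) 4 where
  abs_map_mul_sub_sub_le f _ g _ := abs_translationNumber_mul_sub_sub_le f g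
  map_zpow f _ n := translationNumber_zpow f n
  map_conj g f _ := translationNumber_conj_eq g f

end TranslationNumber

/-! ### Two circle homeomorphisms whose commutator covers an involution -/

section Blaschke

open Complex CircleDeg1Lift
open scoped FourierTransform ComplexConjugate

theorem fourierChar_eq_iff {x y : ℝ} : 𝐞 x = 𝐞 y ↔ ∃ n : ℤ, x = y + n := by
  rw [← Circle.coe_inj, Real.fourierChar_apply, Real.fourierChar_apply, exp_eq_exp_iff_exists_int]
  refine exists_congr fun n => ?_
  have h : ((2 * Real.pi * y : ℝ) : ℂ) * I + n * (2 * Real.pi * I) =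
      ((2 * Real.pi * (y + n) : ℝ) : ℂ) * I := by
    push_cast
    ring
  rw [h, mul_left_inj' I_ne_zero, ofReal_inj, mul_right_inj' (by positivity)]

theorem coe_fourierChar_add (x y : ℝ) : (𝐞 (x + y) : ℂ) = 𝐞 x * 𝐞 y := by
  rw [AddChar.map_add_eq_mul, Circle.coe_mul]

theorem coe_fourierChar_neg (x : ℝ) : (𝐞 (-x) : ℂ) = (𝐞 x : ℂ)⁻¹ := by
  rw [AddChar.map_neg_eq_inv, Circle.coe_inv]

theorem fourierChar_add_one (x : ℝ) : 𝐞 (x + 1) = 𝐞 x :=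
  fourierChar_eq_iff.2 ⟨1, by simp⟩

theorem coe_fourierChar_one_div_four : (𝐞 (1 / 4) : ℂ) = I := by
  have h : ((2 * Real.pi * (1 / 4) : ℝ) : ℂ) = Real.pi / 2 := by
    push_cast
    ring
  rw [Real.fourierChar_apply, h, exp_pi_div_two_mul_I]

theorem coe_fourierChar_arg_div_pi {w : ℂ} (hw : w ≠ 0) :
    (𝐞 (arg w / Real.pi) : ℂ) = w / conj w := by
  have hexp : (𝐞 (arg w / Real.pi) : ℂ) = exp (arg w * I) ^ 2 := by
    have hpi : (Real.pi : ℂ) ≠ 0 := ofReal_ne_zero.2 Real.pi_ne_zero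
    rw [Real.fourierChar_apply, ← exp_nat_mul]
    congr 1
    push_cast
    field_simp
  rw [hexp, eq_div_iff ((map_ne_zero _).2 hw)]
  apply mul_left_cancel₀ hw
  calc w * (exp (arg w * I) ^ 2 * conj w)
      = w * conj w * exp (arg w * I) ^ 2 := by ring
    _ = (‖w‖ * exp (arg w * I)) ^ 2 := by rw [mul_conj', mul_pow]
    _ = w * w := by rw [norm_mul_exp_arg_mul_I, sq]

variable {r : ℝ}

theorem re_one_add_mul_pos (hr : |r| < 1) {z : ℂ} (hz : ‖z‖ = 1) : 0 < (1 + r * z).re := by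
  have hre : |r * z.re| < 1 := by
    rw [abs_mul]
    exact (mul_le_of_le_one_right (abs_nonneg _) (hz ▸ abs_re_le_norm z)).trans_lt hr
  simp only [add_re, one_re, re_ofReal_mul]
  linarith [(abs_lt.1 hre).1]

theorem one_add_mul_ne_zero (hr : |r| < 1) {z : ℂ} (hz : ‖z‖ = 1) : 1 + r * z ≠ 0 := fun h => by
  simpa [h] using re_one_add_mul_pos hr hz

theorem one_sub_mul_I_mul_ne_zero (hr : |r| < 1) {z : ℂ} (hz : ‖z‖ = 1) :
    1 - r * I * z ≠ 0 := by
  have h := one_add_mul_ne_zero hr (z := -(I * z)) (by simp [hz])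
  rwa [mul_neg, ← sub_eq_add_neg, ← mul_assoc] at h

/-- The lift to the line of the Blaschke factor `z ↦ (z + r) / (1 + r z)` restricted to the unit
circle, written as a displacement of less than half a turn. -/
def blaschkeLift (r x : ℝ) : ℝ := x + arg (1 + r * 𝐞 (-x)) / Real.pi

theorem blaschkeLift_add_one (r x : ℝ) : blaschkeLift r (x + 1) = blaschkeLift r x + 1 := by
  have h : 𝐞 (-(x + 1)) = 𝐞 (-x) := by rw [AddChar.map_neg_eq_inv, fourierChar_add_one,
    AddChar.map_neg_eq_inv]
  rw [blaschkeLift, blaschkeLift, h]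
  ring

theorem abs_blaschkeLift_sub_lt (hr : |r| < 1) (x : ℝ) : |blaschkeLift r x - x| < 1 / 2 := by
  have h := abs_arg_lt_pi_div_two_iff.2 (Or.inl (re_one_add_mul_pos hr (Circle.norm_coe (𝐞 (-x)))))
  rw [blaschkeLift, add_sub_cancel_left, abs_div, abs_of_pos Real.pi_pos,
    div_lt_iff₀ Real.pi_pos]
  linarith

theorem fourierChar_blaschkeLift (hr : |r| < 1) (x : ℝ) :
    (𝐞 (blaschkeLift r x) : ℂ) = (𝐞 x + r) / (1 + r * 𝐞 x) := by
  have hw : 1 + r * (𝐞 (-x) : ℂ) ≠ 0 := one_add_mul_ne_zero hr (Circle.norm_coe _)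
  have hz : (𝐞 x : ℂ) ≠ 0 := Circle.coe_ne_zero _
  have hconj : conj (1 + r * (𝐞 (-x) : ℂ)) = 1 + r * 𝐞 x := by
    rw [map_add, map_mul, map_one, conj_ofReal, ← Circle.coe_inv_eq_conj,
      ← AddChar.map_neg_eq_inv, neg_neg]
  rw [blaschkeLift, coe_fourierChar_add, coe_fourierChar_arg_div_pi hw, hconj,
    coe_fourierChar_neg]
  field_simp

theorem leftInverse_blaschkeLift (hr : |r| < 1) :
    Function.LeftInverse (blaschkeLift (-r)) (blaschkeLift r) := by
  intro x
  have hr' : |-r| < 1 := by rwa [abs_neg]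
  have hchar : 𝐞 (blaschkeLift (-r) (blaschkeLift r x)) = 𝐞 x := by
    have hx := fourierChar_blaschkeLift hr x
    rw [eq_div_iff (one_add_mul_ne_zero hr (Circle.norm_coe _))] at hx
    rw [← Circle.coe_inj, fourierChar_blaschkeLift hr',
      div_eq_iff (one_add_mul_ne_zero hr' (Circle.norm_coe _))]
    push_cast
    linear_combination hx
  obtain ⟨n, hn⟩ := fourierChar_eq_iff.1 hchar
  have hdisp : |(n : ℝ)| < 1 := by
    have h₁ := abs_lt.1 (abs_blaschkeLift_sub_lt hr x)
    have h₂ := abs_lt.1 (abs_blaschkeLift_sub_lt hr' (blaschkeLift r x))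
    exact abs_lt.2 ⟨by linarith [h₁.1, h₂.1], by linarith [h₁.2, h₂.2]⟩
  have hn0 : n = 0 := Int.abs_lt_one_iff.1 (by exact_mod_cast hdisp)
  simpa [hn0] using hn

theorem continuous_blaschkeLift (hr : |r| < 1) : Continuous (blaschkeLift r) := by
  refine continuous_id.add (Continuous.div_const (continuous_iff_continuousAt.2 fun x => ?_) _)
  refine ContinuousAt.comp (f := fun x : ℝ => 1 + (r : ℂ) * 𝐞 (-x))
    (continuousAt_arg (Or.inl (re_one_add_mul_pos hr (Circle.norm_coe _)))) ?_
  fun_prop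

theorem monotone_blaschkeLift (hr : |r| < 1) : Monotone (blaschkeLift r) := by
  rcases (continuous_blaschkeLift hr).strictMono_of_inj (leftInverse_blaschkeLift hr).injective
    with h | h
  · exact h.monotone
  · linarith [h (zero_lt_one' ℝ), zero_add (1 : ℝ) ▸ blaschkeLift_add_one r 0]

/-- The lift of a Blaschke factor as an invertible monotone degree one lift. -/
def blaschkeUnit (r : ℝ) (hr : |r| < 1) : CircleDeg1Liftˣ where
  val := ⟨⟨blaschkeLift r, monotone_blaschkeLift hr⟩, blaschkeLift_add_one r⟩
  inv := ⟨⟨blaschkeLift (-r), monotone_blaschkeLift (by rwa [abs_neg])⟩, blaschkeLift_add_one (-r)⟩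
  val_inv := by
    ext x
    have h := leftInverse_blaschkeLift (r := -r) (by rwa [abs_neg]) x
    rwa [neg_neg] at h
  inv_val := by
    ext x
    exact leftInverse_blaschkeLift hr x

/-- The conjugate of `blaschkeUnit` by the quarter turn; it covers
`z ↦ (z + r i) / (1 - r i z)`. -/
def blaschkeTurn (r : ℝ) (hr : |r| < 1) : CircleDeg1Liftˣ :=
  translate (Multiplicative.ofAdd (1 / 4)) * blaschkeUnit r hr *
    (translate (Multiplicative.ofAdd (1 / 4)))⁻¹

theorem fourierChar_blaschkeUnit (hr : |r| < 1) (x : ℝ) :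
    (𝐞 (blaschkeUnit r hr x) : ℂ) * (1 + r * 𝐞 x) = 𝐞 x + r :=
  (eq_div_iff (one_add_mul_ne_zero hr (Circle.norm_coe _))).1 (fourierChar_blaschkeLift hr x)

theorem fourierChar_blaschkeTurn (hr : |r| < 1) (x : ℝ) :
    (𝐞 (blaschkeTurn r hr x) : ℂ) * (1 - r * I * 𝐞 x) = 𝐞 x + r * I := by
  have hturn : blaschkeTurn r hr x = 1 / 4 + blaschkeUnit r hr (-(1 / 4) + x) := by
    simp [blaschkeTurn, mul_apply]
  have h := fourierChar_blaschkeUnit hr (-(1 / 4) + x)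
  rw [coe_fourierChar_add, coe_fourierChar_neg, coe_fourierChar_one_div_four, inv_I] at h
  rw [hturn, coe_fourierChar_add, coe_fourierChar_one_div_four]
  linear_combination I * h - (𝐞 x : ℂ) * I_sq

/-- The algebra behind `fourierChar_commutator`: if `p`, `q` are the images of `z` under the two
Blaschke maps and `P`, `S` those of `q`, `p` under the respective other map, then eliminating
`p`, `q` and `z` gives the Möbius relation between `P` and `S`. -/
theorem blaschke_commutator_relation {s z p q P S : ℂ} (hs : s ^ 4 + 2 * s ^ 2 = 1)
    (hp : p * (1 + s * z) = z + s) (hq : q * (1 - s * I * z) = z + s * I)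
    (hP : P * (1 + s * q) = q + s) (hS : S * (1 - s * I * p) = p + s * I)
    (hp0 : 1 + s * z ≠ 0) (hq0 : 1 - s * I * z ≠ 0)
    (hP0 : 1 + s * q ≠ 0) (hS0 : 1 - s * I * p ≠ 0) :
    P * (1 - (1 - I) * s * S) = (1 + I) * s - S := by
  set U := 1 + s * z - s * I * (z + s)
  set V := 1 - s * I * z + s * (z + s * I)
  have hPV : P * V = z + s * I + s * (1 - s * I * z) := by
    linear_combination (1 - s * I * z) * hP - (P * s - 1) * hq
  have hSU : S * U = z + s + s * I * (1 + s * z) := by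
    linear_combination (1 + s * z) * hS + (S * s * I + 1) * hp
  have hV0 : V ≠ 0 := by
    have : V = (1 + s * q) * (1 - s * I * z) := by linear_combination -s * hq
    exact this ▸ mul_ne_zero hP0 hq0
  have hU0 : U ≠ 0 := by
    have : U = (1 - s * I * p) * (1 + s * z) := by linear_combination s * I * hp
    exact this ▸ mul_ne_zero hS0 hp0
  apply mul_left_cancel₀ (mul_ne_zero hV0 hU0)
  linear_combination U * (1 - (1 - I) * s * S) * hPV +
    (V - (1 - I) * s * (z + s * I + s * (1 - s * I * z))) * hSU -
    ((1 - I) * s * z ^ 2 + 2 * z + s * (1 + I)) * hs +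
    ((s ^ 3 + s ^ 5) * (1 + z ^ 2 + I - z ^ 2 * I) + 2 * (s ^ 2 + s ^ 4) * z) * I_sq

theorem fourierChar_commutator (hr : |r| < 1) (hr4 : r ^ 4 + 2 * r ^ 2 = 1) (x : ℝ) :
    (𝐞 ((⁅blaschkeUnit r hr, blaschkeTurn r hr⁆ : CircleDeg1Liftˣ) x) : ℂ) *
      (1 - (1 - I) * r * 𝐞 x) = (1 + I) * r - 𝐞 x := by
  set a := blaschkeUnit r hr
  set b := blaschkeTurn r hr
  obtain ⟨y, rfl⟩ : ∃ y, b (a y) = x := ⟨(b * a)⁻¹ x, units_apply_inv_apply (b * a) x⟩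
  have hab : (⁅a, b⁆ : CircleDeg1Liftˣ) (b (a y)) = a (b y) := by
    have h : ⁅a, b⁆ * (b * a) = a * b := by rw [commutatorElement_def]; group
    exact congrArg (fun f : CircleDeg1Liftˣ => f y) h
  rw [hab]
  exact blaschke_commutator_relation (by exact_mod_cast hr4)
    (fourierChar_blaschkeUnit hr y) (fourierChar_blaschkeTurn hr y)
    (fourierChar_blaschkeUnit hr (b y)) (fourierChar_blaschkeTurn hr (a y))
    (one_add_mul_ne_zero hr (Circle.norm_coe _)) (one_sub_mul_I_mul_ne_zero hr (Circle.norm_coe _))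
    (one_add_mul_ne_zero hr (Circle.norm_coe _)) (one_sub_mul_I_mul_ne_zero hr (Circle.norm_coe _))

theorem fourierChar_commutator_sq (hr : |r| < 1) (hr4 : r ^ 4 + 2 * r ^ 2 = 1) (x : ℝ) :
    𝐞 ((⁅blaschkeUnit r hr, blaschkeTurn r hr⁆ ^ 2 : CircleDeg1Liftˣ) x) = 𝐞 x := by
  set g := ⁅blaschkeUnit r hr, blaschkeTurn r hr⁆
  have hx : (𝐞 (g x) : ℂ) * (1 - (1 - I) * r * 𝐞 x) = (1 + I) * r - 𝐞 x :=
    fourierChar_commutator hr hr4 x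
  have hgx : (𝐞 (g (g x)) : ℂ) * (1 - (1 - I) * r * 𝐞 (g x)) = (1 + I) * r - 𝐞 (g x) :=
    fourierChar_commutator hr hr4 (g x)
  have hden : 1 - (1 - I) * r * (𝐞 (g x) : ℂ) ≠ 0 := by
    intro h
    rw [h, mul_zero] at hgx
    have hrC : 1 - 2 * (r : ℂ) ^ 2 = 0 := by
      linear_combination h + (1 - I) * r * hgx - r ^ 2 * I_sq
    have hrR : 1 - 2 * r ^ 2 = 0 := by exact_mod_cast hrC
    nlinarith
  rw [sq, ← Circle.coe_inj]
  apply mul_right_cancel₀ hden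
  change (𝐞 (g (g x)) : ℂ) * _ = _
  linear_combination hgx - hx

theorem commutator_sq_apply_zero_ne_zero (hr : |r| < 1) (hr4 : r ^ 4 + 2 * r ^ 2 = 1) :
    (⁅blaschkeUnit r hr, blaschkeTurn r hr⁆ ^ 2 : CircleDeg1Liftˣ) (0 : ℝ) ≠ 0 := by
  set g := ⁅blaschkeUnit r hr, blaschkeTurn r hr⁆
  intro h
  have hfix : g 0 = 0 := by
    have hiter := iterate_pos_eq_iff (g : CircleDeg1Lift) (x := 0) (m := 0) zero_lt_two
    simp only [Int.cast_zero, mul_zero, add_zero] at hiter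
    exact hiter.1 h
  have h0 : (𝐞 (g 0) : ℂ) * (1 - (1 - I) * r * 𝐞 0) = (1 + I) * r - 𝐞 0 :=
    fourierChar_commutator hr hr4 0
  rw [hfix, AddChar.map_zero_eq_one, Circle.coe_one] at h0
  have hrC : (r : ℂ) = 1 := by linear_combination -h0 / 2
  exact (abs_lt.1 hr).2.ne (by exact_mod_cast hrC)

end Blaschke

section Central

open CircleDeg1Lift
open scoped FourierTransform

theorem apply_eq_add_translationNumber {f : CircleDeg1Lift} (hf : ∀ x, 𝐞 (f x) = 𝐞 x) (x : ℝ) :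
    f x = x + translationNumber f := by
  obtain ⟨n, hn⟩ := fourierChar_eq_iff.1 (hf x)
  rw [translationNumber_of_eq_add_int f hn, hn]

theorem mem_center_of_fourierChar_eq {f : CircleDeg1Liftˣ} (hf : ∀ x, 𝐞 (f x) = 𝐞 x) :
    f ∈ Subgroup.center CircleDeg1Liftˣ := by
  obtain ⟨n, hn⟩ := fourierChar_eq_iff.1 (hf 0)
  have htrans (x : ℝ) : f x = x + n := by
    rw [apply_eq_add_translationNumber hf, translationNumber_of_eq_add_int _ hn]
  refine Subgroup.mem_center_iff.2 fun g => ?_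
  ext x
  change g (f x) = f (g x)
  rw [htrans, htrans, map_add_int]

theorem exists_commutator_sq_mem_center :
    ∃ a b : CircleDeg1Liftˣ, ⁅a, b⁆ ^ 2 ∈ Subgroup.center CircleDeg1Liftˣ ∧
      translationNumber (⁅a, b⁆ ^ 2 : CircleDeg1Liftˣ) ≠ 0 := by
  obtain ⟨r, ⟨hr0, hr1⟩, hr4⟩ : ∃ r ∈ Set.Ioo (0 : ℝ) 1, r ^ 4 + 2 * r ^ 2 = 1 :=
    intermediate_value_Ioo zero_le_one (by fun_prop) (by norm_num)
  have hr : |r| < 1 := by rwa [abs_of_pos hr0]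
  have hchar := fourierChar_commutator_sq hr hr4
  refine ⟨blaschkeUnit r hr, blaschkeTurn r hr, mem_center_of_fourierChar_eq hchar, fun h => ?_⟩
  apply commutator_sq_apply_zero_ne_zero hr hr4
  rw [apply_eq_add_translationNumber hchar, h, add_zero]

theorem exists_prod_commutator_mul_center_eq_one {ℓ : ℕ} (hℓ : 2 ≤ ℓ) :
    ∃ (a b : Fin ℓ → CircleDeg1Liftˣ) (c : Subgroup.center CircleDeg1Liftˣ),
      (List.ofFn fun i => ⁅a i, b i⁆).prod * (c : CircleDeg1Liftˣ) = 1 ∧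
      translationNumber (c : CircleDeg1Liftˣ) ≠ 0 := by
  obtain ⟨m, rfl⟩ : ∃ m, ℓ = m + 2 := ⟨ℓ - 2, by omega⟩
  obtain ⟨a, b, hc, htrans⟩ := exists_commutator_sq_mem_center
  refine ⟨fun i => if (i : ℕ) < 2 then a else 1, fun i => if (i : ℕ) < 2 then b else 1,
    ⟨_, inv_mem hc⟩, ?_, ?_⟩
  · have hprod : (List.ofFn fun i : Fin (m + 2) =>
        ⁅if (i : ℕ) < 2 then a else 1, if (i : ℕ) < 2 then b else 1⁆).prod = ⁅a, b⁆ ^ 2 := by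
      simp [List.ofFn_succ, List.prod_cons, Fin.val_succ, sq]
    rw [hprod]
    exact mul_inv_cancel _
  · change translationNumber ((⁅a, b⁆ ^ 2)⁻¹ : CircleDeg1Liftˣ) ≠ 0
    rw [translationNumber_units_inv]
    exact neg_ne_zero.2 htrans

end Central

/-! ### The covering of the surface defined by a boundary word -/

section Sector

open Complex

/-- The exponential map onto the punctured plane, scaled so that `k + t` is sent to `arc ℓ k t`:
the real part of the argument is an angle, with a full turn equal to `4ℓ`. -/
def angleExp (ℓ : ℕ) (s : ℂ) : ℂ := exp (2 * Real.pi * I / (4 * ℓ) * s)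

theorem coe_arc (ℓ k : ℕ) (t : ℝ) : (arc ℓ k t : ℂ) = angleExp ℓ (k + t) := by
  simp only [arc, angleExp]
  push_cast
  ring_nf

theorem norm_arc (ℓ k : ℕ) (t : ℝ) : ‖(arc ℓ k t : ℂ)‖ = 1 :=
  norm_exp_ofReal_mul_I _

/-- The open sector of the disc of the angles at distance less than `1 / 2` from `x`, where a full
turn is `4ℓ`. -/
def sector (ℓ : ℕ) (x : ℝ) : Set Disc := {z | ∃ s : ℂ, |s.re - x| < 1 / 2 ∧ angleExp ℓ s = z}

theorem arc_mem_sector {ℓ k : ℕ} {t x : ℝ} (h : |k + t - x| < 1 / 2) : arc ℓ k t ∈ sector ℓ x :=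
  ⟨k + t, by simpa using h, (coe_arc ℓ k t).symm⟩

variable {ℓ : ℕ} (hℓ : 0 < ℓ)

include hℓ

theorem angleExp_factor_ne_zero : 2 * Real.pi * I / (4 * ℓ : ℂ) ≠ 0 :=
  div_ne_zero two_pi_I_ne_zero (by simpa using hℓ.ne')

theorem angleExp_eq_iff {s s' : ℂ} :
    angleExp ℓ s = angleExp ℓ s' ↔ ∃ m : ℤ, s = s' + 4 * ℓ * m := by
  have hc := angleExp_factor_ne_zero hℓ
  have hℓ' : (4 * ℓ : ℂ) ≠ 0 := by simpa using hℓ.ne'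
  rw [angleExp, angleExp, exp_eq_exp_iff_exists_int]
  refine exists_congr fun m => ?_
  rw [← mul_right_inj' hc (b := s), mul_add, ← mul_assoc _ (4 * (ℓ : ℂ)), div_mul_cancel₀ _ hℓ',
    mul_comm (m : ℂ)]

theorem isOpen_sector (x : ℝ) : IsOpen (sector ℓ x) := by
  have hopen : IsOpenMap (angleExp ℓ) :=
    isOpenMap_exp.comp (Homeomorph.mulLeft₀ _ (angleExp_factor_ne_zero hℓ)).isOpenMap
  have hstrip : IsOpen {s : ℂ | |s.re - x| < 1 / 2} := isOpen_lt (by fun_prop) (by fun_prop)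
  exact (hopen _ hstrip).preimage continuous_subtype_val

theorem exists_angleExp_eq {z : ℂ} (hz : z ≠ 0) : ∃ s : ℂ, 0 ≤ s.re ∧ angleExp ℓ s = z := by
  have hc := angleExp_factor_ne_zero hℓ
  have hℓ' : (1 : ℝ) ≤ ℓ := by exact_mod_cast hℓ
  set s := log z / (2 * Real.pi * I / (4 * ℓ)) with hs
  have hsz : angleExp ℓ s = z := by rw [angleExp, hs, mul_div_cancel₀ _ hc, exp_log hz]
  obtain ⟨m, hm⟩ := exists_nat_ge (-s.re)
  refine ⟨s + 4 * ℓ * (m : ℤ), ?_, ((angleExp_eq_iff hℓ).2 ⟨m, rfl⟩).trans hsz⟩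
  have : (s + 4 * ℓ * (m : ℤ)).re = s.re + 4 * ℓ * m := by simp
  rw [this]
  nlinarith [(m.cast_nonneg : (0 : ℝ) ≤ m)]

theorem exists_mem_sector {z : Disc} (hz : (z : ℂ) ≠ 0) :
    ∃ k : ℕ, z ∈ sector ℓ k ∨ z ∈ sector ℓ (k + 1 / 2) := by
  obtain ⟨s, h0, hs⟩ := exists_angleExp_eq hℓ hz
  have hfloor := Nat.floor_le h0
  have hlt := Nat.lt_floor_add_one s.re
  refine ⟨⌊s.re⌋₊, ?_⟩
  rcases hfloor.eq_or_lt with h | h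
  · exact .inl ⟨s, by rw [h, sub_self]; norm_num, hs⟩
  · exact .inr ⟨s, abs_sub_lt_iff.2 ⟨by linarith, by linarith⟩, hs⟩

theorem modEq_of_mem_sector {z : Disc} {j k : ℕ} {x : ℝ} (hj : z ∈ sector ℓ (j + x))
    (hk : z ∈ sector ℓ (k + x)) : j ≡ k [MOD 4 * ℓ] := by
  obtain ⟨s, hs, hsz⟩ := hj
  obtain ⟨s', hs', hsz'⟩ := hk
  obtain ⟨m, hm⟩ := (angleExp_eq_iff hℓ).1 (hsz'.trans hsz.symm)
  have hre : s'.re = s.re + 4 * ℓ * m := by simp [hm]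
  have habs : |((k - j - 4 * ℓ * m : ℤ) : ℝ)| < 1 := by
    push_cast
    rw [abs_lt] at hs hs' ⊢
    constructor <;> linarith
  have hzero : (k : ℤ) - j - 4 * ℓ * m = 0 := Int.abs_lt_one_iff.1 (by exact_mod_cast habs)
  exact Nat.modEq_iff_dvd.2 ⟨m, by push_cast; linarith⟩

theorem arc_notMem_sector {k : ℕ} {t x : ℝ} {n : ℤ} (h : k + t = x + n + 1 / 2) :
    arc ℓ k t ∉ sector ℓ x := by
  rintro ⟨s, hs, hsz⟩
  rw [coe_arc] at hsz
  obtain ⟨m, hm⟩ := (angleExp_eq_iff hℓ).1 hsz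
  have hre : s.re = k + t + 4 * ℓ * m := by simp [hm]
  rw [abs_lt] at hs
  have hneg : ((n + 4 * ℓ * m : ℤ) : ℝ) < (0 : ℤ) := by push_cast; linarith
  have hpos : ((-1 : ℤ) : ℝ) < (n + 4 * ℓ * m : ℤ) := by push_cast; linarith
  have := Int.cast_lt.1 hneg
  have := Int.cast_lt.1 hpos
  omega

end Sector

section PairedSide

/-- The index of the side of the polygon glued to the `k`-th one. -/
def pairedSide (k : ℕ) : ℕ := if k % 4 < 2 then k + 2 else k - 2

theorem pairedSide_pairedSide (k : ℕ) : pairedSide (pairedSide k) = k := by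
  unfold pairedSide
  split_ifs <;> omega

theorem pairedSide_lt {ℓ k : ℕ} (hk : k < 4 * ℓ) : pairedSide k < 4 * ℓ := by
  unfold pairedSide
  split_ifs <;> omega

theorem pairedSide_mod_lt_two_iff {k : ℕ} : pairedSide k % 4 < 2 ↔ ¬k % 4 < 2 := by
  unfold pairedSide
  split_ifs <;> omega

theorem SidePairing.exists_arc {ℓ : ℕ} {z z' : Disc} (h : SidePairing ℓ z z') :
    ∃ k < 4 * ℓ, ∃ t : unitInterval, z = arc ℓ k t ∧ z' = arc ℓ (pairedSide k) (1 - t) := by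
  cases h with
  | a i t => exact ⟨4 * i, by omega, t, rfl, by simp [pairedSide]⟩
  | b i t => exact ⟨4 * i + 1, by omega, t, rfl, by simp [pairedSide, Nat.add_mod]⟩

theorem toSurface_arc_pairedSide {ℓ k : ℕ} (hk : k < 4 * ℓ) (t : unitInterval) :
    toSurface ℓ (arc ℓ k t) = toSurface ℓ (arc ℓ (pairedSide k) (1 - t)) := by
  obtain ⟨i, hi, r, hr, rfl⟩ : ∃ i < ℓ, ∃ r < 4, k = 4 * i + r :=
    ⟨k / 4, by omega, k % 4, by omega, (Nat.div_add_mod k 4).symm⟩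
  have ha := toSurface_a ℓ ⟨i, hi⟩
  have hb := toSurface_b ℓ ⟨i, hi⟩
  interval_cases r
  · simpa [pairedSide] using ha t
  · simpa [pairedSide, Nat.add_mod] using hb t
  · simpa [pairedSide, Nat.add_mod] using (ha (unitInterval.symm t)).symm
  · simpa [pairedSide, Nat.add_mod] using (hb (unitInterval.symm t)).symm

/-- The gluing of the polygon identifies all its vertices. -/
theorem eq_zero_of_eq_pairedSide_succ {α : Type*} {ℓ : ℕ} {f : ℕ → α}
    (hf : ∀ k < 4 * ℓ, f k = f (pairedSide k + 1)) {k : ℕ} (hk : k ≤ 4 * ℓ) : f k = f 0 := by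
  have hsucc : ∀ k < 4 * ℓ, f (k + 1) = f k := by
    intro k hk
    obtain ⟨i, hi, r, hr, rfl⟩ : ∃ i < ℓ, ∃ r < 4, k = 4 * i + r :=
      ⟨k / 4, by omega, k % 4, by omega, (Nat.div_add_mod k 4).symm⟩
    have h0 : f (4 * i) = f (4 * i + 3) := by simpa [pairedSide] using hf (4 * i) (by omega)
    have h1 : f (4 * i + 1) = f (4 * i + 4) := by
      simpa [pairedSide, Nat.add_mod] using hf (4 * i + 1) (by omega)
    have h2 : f (4 * i + 2) = f (4 * i + 1) := by
      simpa [pairedSide, Nat.add_mod] using hf (4 * i + 2) (by omega)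
    have h3 : f (4 * i + 3) = f (4 * i + 2) := by
      simpa [pairedSide, Nat.add_mod] using hf (4 * i + 3) (by omega)
    interval_cases r <;> grind
  induction k with
  | zero => rfl
  | succ k ih => exact (hsucc k hk).trans (ih (by omega))

end PairedSide

section Cover

variable {Q : Type*} [Group Q] {ℓ : ℕ} {w : ℕ → Q}

/-- For an assignment of elements of `Q` to the sides of the polygon, compatible with the side
pairing and with trivial product around the boundary, `w k` is the product of the first `k` of
them; it is extended periodically to all `k`. -/
structure IsBoundaryWord (ℓ : ℕ) (w : ℕ → Q) : Prop where
  zero : w 0 = 1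
  periodic : Function.Periodic w (4 * ℓ)
  inv_mul_succ : ∀ k < 4 * ℓ, (w k)⁻¹ * w (k + 1) = (w (pairedSide k + 1))⁻¹ * w (pairedSide k)

/-- The side pairing of the copies of the polygon indexed by `Q`: in the copy `q`, the initial
vertex of the `k`-th side is thought of as the element `q * w k`, and the sides are glued so that
these elements match. -/
inductive LiftPairing (ℓ : ℕ) (w : ℕ → Q) : Disc × Q → Disc × Q → Prop
  | side (k : ℕ) (hk : k < 4 * ℓ) (t : unitInterval) (q q' : Q)
      (h : q * w k = q' * w (pairedSide k + 1)) :
      LiftPairing ℓ w (arc ℓ k t, q) (arc ℓ (pairedSide k) (1 - t), q')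

theorem IsBoundaryWord.mul_succ_eq (hw : IsBoundaryWord ℓ w) {k : ℕ} (hk : k < 4 * ℓ) {q q' : Q}
    (h : q * w k = q' * w (pairedSide k + 1)) : q * w (k + 1) = q' * w (pairedSide k) := by
  rw [← mul_inv_cancel_left (w k) (w (k + 1)), hw.inv_mul_succ k hk, ← mul_assoc, h, ← mul_assoc,
    mul_inv_cancel_right]

theorem IsBoundaryWord.eq_of_modEq (hw : IsBoundaryWord ℓ w) {j k : ℕ} (h : j ≡ k [MOD 4 * ℓ]) :
    w j = w k := by
  rw [← hw.periodic.map_mod_nat j, h, hw.periodic.map_mod_nat]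

theorem LiftPairing.symm (hw : IsBoundaryWord ℓ w) {p p' : Disc × Q} (h : LiftPairing ℓ w p p') :
    LiftPairing ℓ w p' p := by
  obtain ⟨k, hk, t, q, q', h⟩ := h
  have := LiftPairing.side (pairedSide k) (pairedSide_lt hk) (unitInterval.symm t) q' q
    (by rw [pairedSide_pairedSide, hw.mul_succ_eq hk h])
  simpa [pairedSide_pairedSide] using this

theorem LiftPairing.smul {p p' : Disc × Q} (h : LiftPairing ℓ w p p') (g : Q) :
    LiftPairing ℓ w (p.1, g * p.2) (p'.1, g * p'.2) := by
  obtain ⟨k, hk, t, q, q', h⟩ := h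
  exact .side k hk t _ _ (by simp only [mul_assoc, h])

/-- The space obtained by gluing copies of the polygon indexed by `Q`. -/
def Cover (ℓ : ℕ) (w : ℕ → Q) : Type _ := Quot (LiftPairing ℓ w)

namespace Cover

/-- The point of the covering given by a point in a copy of the polygon. -/
def mk (ℓ : ℕ) (w : ℕ → Q) (p : Disc × Q) : Cover ℓ w := Quot.mk _ p

/-- The projection of the covering to the surface. -/
def proj : Cover ℓ w → Surface ℓ :=
  Quot.lift (fun p : Disc × Q => toSurface ℓ p.1) (by
    rintro _ _ ⟨k, hk, t, q, q', h⟩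
    exact toSurface_arc_pairedSide hk t)

instance : MulAction Q (Cover ℓ w) where
  smul g := Quot.map (fun p => (p.1, g * p.2)) fun _ _ h => h.smul g
  one_smul e := by
    induction e using Quot.ind with
    | mk p => exact congrArg (mk ℓ w) (Prod.ext rfl (one_mul p.2))
  mul_smul g h e := by
    induction e using Quot.ind with
    | mk p => exact congrArg (mk ℓ w) (Prod.ext rfl (mul_assoc g h p.2))

theorem smul_mk (g : Q) (p : Disc × Q) : g • mk ℓ w p = mk ℓ w (p.1, g * p.2) := rfl

theorem mk_surjective : Function.Surjective (mk ℓ w) := Quot.mk_surjective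

theorem exists_mk_eq_of_toSurface_eq {z z' : Disc} (h : toSurface ℓ z = toSurface ℓ z') (q : Q) :
    ∃ q' : Q, mk ℓ w (z, q) = mk ℓ w (z', q') := by
  replace h := Quot.eqvGen_exact h
  induction h generalizing q with
  | rel _ _ h =>
    obtain ⟨k, hk, t, rfl, rfl⟩ := h.exists_arc
    exact ⟨q * w k * (w (pairedSide k + 1))⁻¹, Quot.sound (.side k hk t _ _ (by simp))⟩
  | refl _ => exact ⟨q, rfl⟩
  | symm _ _ _ ih =>
    obtain ⟨q', hq'⟩ := ih 1
    refine ⟨q * q'⁻¹, ?_⟩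
    have := congrArg (fun e => (q * q'⁻¹) • e) hq'
    simp only [smul_mk, mul_one, inv_mul_cancel_right] at this
    exact this.symm
  | trans x y z _ _ ih1 ih2 =>
    obtain ⟨q', h1⟩ := ih1 q
    obtain ⟨q'', h2⟩ := ih2 q'
    exact ⟨q'', h1.trans h2⟩

theorem proj_eq_iff {e e' : Cover ℓ w} : proj e = proj e' ↔ e ∈ MulAction.orbit Q e' := by
  obtain ⟨⟨z, q⟩, rfl⟩ := mk_surjective e
  obtain ⟨⟨z', q'⟩, rfl⟩ := mk_surjective e'
  constructor
  · intro h
    obtain ⟨q'', h⟩ := exists_mk_eq_of_toSurface_eq (w := w) h q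
    exact ⟨q'' * q'⁻¹, by simp [smul_mk, h]⟩
  · rintro ⟨g, h⟩
    rw [← h]
    rfl

variable [TopologicalSpace Q]

instance : TopologicalSpace (Cover ℓ w) :=
  inferInstanceAs (TopologicalSpace (Quot (LiftPairing ℓ w)))

theorem isQuotientMap_mk : IsQuotientMap (mk ℓ w) := isQuotientMap_quot_mk

theorem continuous_proj : Continuous (proj (ℓ := ℓ) (w := w)) :=
  continuous_quot_lift _ ((continuous_toSurface ℓ).comp continuous_fst)

theorem isQuotientMap_proj : IsQuotientMap (proj (ℓ := ℓ) (w := w)) := by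
  have h : IsQuotientMap (toSurface ℓ) := isQuotientMap_quot_mk
  have hc : Continuous fun z : Disc => mk ℓ w (z, 1) :=
    isQuotientMap_mk.continuous.comp (by fun_prop)
  exact IsQuotientMap.of_comp hc continuous_proj h

instance [DiscreteTopology Q] : ContinuousConstSMul Q (Cover ℓ w) where
  continuous_const_smul g :=
    isQuotientMap_mk.continuous_iff.2 (isQuotientMap_mk.continuous.comp
      (f := fun p : Disc × Q => (p.1, g * p.2))
      (continuous_fst.prodMk (continuous_of_discreteTopology.comp continuous_snd)))

end Cover

end Cover

section Trivialization

variable {Q ι : Type*} [Group Q] {ℓ : ℕ} {w : ℕ → Q} {S : ι → Set Disc} {v : ι → Q}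

/-- A trivialization of the covering over the image of the open set `⋃ j, S j` in the surface: the
function `(z, q) ↦ q * v j` for `z ∈ S j` is well defined and compatible with the gluing. -/
structure IsTrivialization (ℓ : ℕ) (w : ℕ → Q) (S : ι → Set Disc) (v : ι → Q) : Prop where
  isOpen : ∀ j, IsOpen (S j)
  label_eq : ∀ {z i j}, z ∈ S i → z ∈ S j → v i = v j
  exists_of_liftPairing : ∀ {p p' j}, LiftPairing ℓ w p p' → p.1 ∈ S j →
    ∃ i, p'.1 ∈ S i ∧ p.2 * v j = p'.2 * v i

theorem isTrivialization_interior :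
    IsTrivialization ℓ w (fun _ : Unit => {z : Disc | ‖(z : ℂ)‖ < 1}) fun _ => 1 where
  isOpen _ := isOpen_lt (by fun_prop) (by fun_prop)
  label_eq _ _ := rfl
  exists_of_liftPairing := by
    rintro _ _ _ ⟨k, hk, t, q, q', h⟩ hlt
    exact absurd hlt (by simp [norm_arc])

theorem isTrivialization_vertex (hℓ : 0 < ℓ) (hw : IsBoundaryWord ℓ w) :
    IsTrivialization ℓ w (fun k : ℕ => sector ℓ k) w where
  isOpen k := isOpen_sector hℓ k
  label_eq hi hj := hw.eq_of_modEq
    (modEq_of_mem_sector hℓ (x := 0) (by simpa using hi) (by simpa using hj))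
  exists_of_liftPairing := by
    rintro _ _ j ⟨k, hk, t, q, q', h⟩ (hj : arc ℓ k t ∈ sector ℓ j)
    have hlabel : ∀ i : ℕ, |(k + t - i : ℝ)| < 1 / 2 → w j = w i := fun i hi =>
      hw.eq_of_modEq (modEq_of_mem_sector hℓ (x := 0) (by simpa using hj)
        (by simpa using arc_mem_sector hi))
    have ht0 := t.2.1
    have ht1 := t.2.2
    rcases lt_trichotomy (t : ℝ) (1 / 2) with ht | ht | ht
    · refine ⟨pairedSide k + 1, arc_mem_sector ?_, ?_⟩
      · push_cast
        exact abs_sub_lt_iff.2 ⟨by linarith, by linarith⟩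
      · rw [hlabel k (abs_sub_lt_iff.2 ⟨by linarith, by linarith⟩), h]
    · exact absurd hj (arc_notMem_sector hℓ (n := k - j) (by push_cast; linarith))
    · refine ⟨pairedSide k, arc_mem_sector ?_, ?_⟩
      · exact abs_sub_lt_iff.2 ⟨by linarith, by linarith⟩
      · rw [hlabel (k + 1) (by push_cast; exact abs_sub_lt_iff.2 ⟨by linarith, by linarith⟩),
          hw.mul_succ_eq hk h]

/-- The label of the `k`-th side: the initial vertex of the side with respect to the orientation
that agrees for the two sides of a pair. -/
def edgeLabel (w : ℕ → Q) (k : ℕ) : Q := if k % 4 < 2 then w k else w (k + 1)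

theorem IsBoundaryWord.edgeLabel_eq_of_modEq (hw : IsBoundaryWord ℓ w) {j k : ℕ}
    (h : j ≡ k [MOD 4 * ℓ]) : edgeLabel w j = edgeLabel w k := by
  have hmod : j % 4 = k % 4 := h.of_mul_right ℓ
  rw [edgeLabel, edgeLabel, hmod, hw.eq_of_modEq h, hw.eq_of_modEq (h.add_right 1)]

theorem IsBoundaryWord.mul_edgeLabel_eq (hw : IsBoundaryWord ℓ w) {k : ℕ} (hk : k < 4 * ℓ)
    {q q' : Q} (h : q * w k = q' * w (pairedSide k + 1)) :
    q * edgeLabel w k = q' * edgeLabel w (pairedSide k) := by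
  by_cases hmod : k % 4 < 2
  · simp only [edgeLabel, pairedSide_mod_lt_two_iff, hmod, not_true_eq_false, if_true, if_false, h]
  · simp only [edgeLabel, pairedSide_mod_lt_two_iff, hmod, not_false_eq_true, if_true, if_false,
      hw.mul_succ_eq hk h]

theorem isTrivialization_edge (hℓ : 0 < ℓ) (hw : IsBoundaryWord ℓ w) :
    IsTrivialization ℓ w (fun k : ℕ => sector ℓ (k + 1 / 2)) (edgeLabel w) where
  isOpen k := isOpen_sector hℓ _
  label_eq hi hj := hw.edgeLabel_eq_of_modEq (modEq_of_mem_sector hℓ hi hj)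
  exists_of_liftPairing := by
    rintro _ _ j ⟨k, hk, t, q, q', h⟩ (hj : arc ℓ k t ∈ sector ℓ (j + 1 / 2))
    rcases eq_or_lt_of_le t.2.1 with ht0 | ht0
    · exact absurd hj (arc_notMem_sector hℓ (n := k - j - 1) (by push_cast; linarith))
    rcases eq_or_lt_of_le t.2.2 with ht1 | ht1
    · exact absurd hj (arc_notMem_sector hℓ (n := k - j) (by push_cast; linarith))
    refine ⟨pairedSide k, arc_mem_sector (abs_sub_lt_iff.2 ⟨by linarith, by linarith⟩), ?_⟩
    have hjk : arc ℓ k t ∈ sector ℓ (k + 1 / 2) :=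
      arc_mem_sector (abs_sub_lt_iff.2 ⟨by linarith, by linarith⟩)
    rw [hw.edgeLabel_eq_of_modEq (modEq_of_mem_sector hℓ hj hjk), hw.mul_edgeLabel_eq hk h]

namespace Cover

variable [TopologicalSpace Q] [DiscreteTopology Q]

theorem exists_nhds_disjoint_of_isTrivialization (hw : IsBoundaryWord ℓ w)
    (hS : IsTrivialization ℓ w S v) {z : Disc} {k : ι} (hz : z ∈ S k) (q : Q) :
    ∃ U ∈ 𝓝 (mk ℓ w (z, q)), ∀ g : Q, ((g • ·) '' U ∩ U).Nonempty → g = 1 := by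
  let sheet : Cover ℓ w → Prop :=
    Quot.lift (fun p : Disc × Q => ∃ j, p.1 ∈ S j ∧ p.2 * v j = q * v k) fun p p' h => by
      refine propext ⟨?_, ?_⟩
      · rintro ⟨j, hj, hpj⟩
        obtain ⟨i, hi, hij⟩ := hS.exists_of_liftPairing h hj
        exact ⟨i, hi, hij.symm.trans hpj⟩
      · rintro ⟨j, hj, hpj⟩
        obtain ⟨i, hi, hij⟩ := hS.exists_of_liftPairing (h.symm hw) hj
        exact ⟨i, hi, hij.symm.trans hpj⟩
  refine ⟨{e | sheet e}, IsOpen.mem_nhds ?_ ⟨k, hz, rfl⟩, ?_⟩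
  · rw [← isQuotientMap_mk.isOpen_preimage]
    have hpre : mk ℓ w ⁻¹' {e | sheet e} = ⋃ j, S j ×ˢ {q' : Q | q' * v j = q * v k} := by
      ext p
      rw [Set.mem_iUnion]
      rfl
    rw [hpre]
    exact isOpen_iUnion fun j => (hS.isOpen j).prod (isOpen_discrete _)
  · rintro g ⟨_, ⟨e, he, rfl⟩, hge⟩
    obtain ⟨p, rfl⟩ := mk_surjective e
    obtain ⟨j, hj, hpj⟩ : ∃ j, p.1 ∈ S j ∧ p.2 * v j = q * v k := he
    obtain ⟨i, hi, hpi⟩ : ∃ i, p.1 ∈ S i ∧ g * p.2 * v i = q * v k := hge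
    rw [hS.label_eq hi hj, mul_assoc, hpj] at hpi
    simpa using hpi

theorem exists_nhds_disjoint (hℓ : 0 < ℓ) (hw : IsBoundaryWord ℓ w) (e : Cover ℓ w) :
    ∃ U ∈ 𝓝 e, ∀ g : Q, ((g • ·) '' U ∩ U).Nonempty → g = 1 := by
  obtain ⟨⟨z, q⟩, rfl⟩ := mk_surjective e
  by_cases hz : (z : ℂ) = 0
  · exact exists_nhds_disjoint_of_isTrivialization hw isTrivialization_interior (k := ())
      (by simp [hz]) q
  obtain ⟨k, hk | hk⟩ := exists_mem_sector hℓ hz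
  · exact exists_nhds_disjoint_of_isTrivialization hw (isTrivialization_vertex hℓ hw) hk q
  · exact exists_nhds_disjoint_of_isTrivialization hw (isTrivialization_edge hℓ hw) hk q

theorem isQuotientCoveringMap_proj (hℓ : 0 < ℓ) (hw : IsBoundaryWord ℓ w) :
    IsQuotientCoveringMap (proj (ℓ := ℓ) (w := w)) Q where
  toIsQuotientMap := isQuotientMap_proj
  toContinuousConstSMul := inferInstance
  apply_eq_iff_mem_orbit := proj_eq_iff
  disjoint := exists_nhds_disjoint hℓ hw

end Cover

end Trivialization

/-! ### The fundamental group of the surface -/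

section BoundaryLetter

variable {Q : Type*} [Group Q] {ℓ : ℕ}

theorem prod_take_ofFn_succ {n : ℕ} (f : Fin n → Q) (k : Fin n) :
    ((List.ofFn f).take (k + 1)).prod = ((List.ofFn f).take k).prod * f k := by
  rw [List.prod_take_succ _ _ (by simp)]
  simp

/-- The value at the `k`-th side of the polygon of the boundary word
`a₁ b₁ a₁⁻¹ b₁⁻¹ ⋯ a_ℓ b_ℓ a_ℓ⁻¹ b_ℓ⁻¹`, for given values of the letters `aᵢ` and `bᵢ`. -/
def boundaryLetter (A B : Fin ℓ → Q) (k : Fin (4 * ℓ)) : Q :=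
  let i : Fin ℓ := ⟨k / 4, by omega⟩
  ![A i, B i, (A i)⁻¹, (B i)⁻¹] (Fin.ofNat 4 k)

theorem boundaryLetter_four_mul_add (A B : Fin ℓ → Q) (i : Fin ℓ) (r : Fin 4) :
    boundaryLetter A B ⟨4 * i + r, by omega⟩ = ![A i, B i, (A i)⁻¹, (B i)⁻¹] r := by
  have hdiv : (4 * (i : ℕ) + r) / 4 = i := by omega
  have hmod : Fin.ofNat 4 (4 * (i : ℕ) + r) = r := Fin.ext (by simp [Fin.ofNat])
  simp only [boundaryLetter, hdiv, hmod, Fin.eta]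

theorem exists_eq_four_mul_add (k : Fin (4 * ℓ)) :
    ∃ (i : Fin ℓ) (r : Fin 4), k = ⟨4 * i + r, by omega⟩ :=
  ⟨⟨k / 4, by omega⟩, ⟨k % 4, by omega⟩, Fin.ext (Nat.div_add_mod k 4).symm⟩

theorem prod_ofFn_boundaryLetter (A B : Fin ℓ → Q) :
    (List.ofFn (boundaryLetter A B)).prod = (List.ofFn fun i => ⁅A i, B i⁆).prod := by
  rw [List.ofFn_mul', List.prod_flatten, List.map_ofFn]
  congr 2
  funext i
  simp [boundaryLetter_four_mul_add, commutatorElement_def, mul_assoc, List.ofFn_succ]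

theorem boundaryLetter_pairedSide (A B : Fin ℓ → Q) (k : Fin (4 * ℓ)) :
    boundaryLetter A B ⟨pairedSide k, pairedSide_lt k.2⟩ = (boundaryLetter A B k)⁻¹ := by
  obtain ⟨i, r, rfl⟩ := exists_eq_four_mul_add k
  have h := boundaryLetter_four_mul_add A B i
  have h0 := h 0
  have h1 := h 1
  have h2 := h 2
  have h3 := h 3
  fin_cases r <;> simp_all [pairedSide, Nat.add_mod]

end BoundaryLetter

section SideClass

variable {ℓ : ℕ}

theorem toSurface_arc_eq_vertex {k : ℕ} (hk : k ≤ 4 * ℓ) : toSurface ℓ (arc ℓ k 0) = vertex ℓ := by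
  refine eq_zero_of_eq_pairedSide_succ (f := fun k => toSurface ℓ (arc ℓ k 0)) (fun k hk => ?_) hk
  simpa [arc_one] using toSurface_arc_pairedSide hk 0

/-- The `k`-th side of the polygon as a path in the disc. -/
def sidePath (ℓ k : ℕ) : Path (arc ℓ k 0) (arc ℓ (k + 1) 0) where
  toFun t := arc ℓ k t
  continuous_toFun := (continuous_arc ℓ k).comp continuous_subtype_val
  source' := by simp
  target' := by simp [arc_one]

/-- The image of the `k`-th side of the polygon, as a loop in the surface. -/
def sideLoop (k : Fin (4 * ℓ)) : Path (vertex ℓ) (vertex ℓ) :=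
  ((sidePath ℓ k).map (continuous_toSurface ℓ)).cast (toSurface_arc_eq_vertex k.2.le).symm
    (toSurface_arc_eq_vertex k.2).symm

theorem sideLoop_apply (k : Fin (4 * ℓ)) (t : unitInterval) :
    sideLoop k t = toSurface ℓ (arc ℓ k t) := rfl

/-- The class of the `k`-th side of the polygon in the fundamental group, inverted as in `genA`. -/
def sideClass (k : Fin (4 * ℓ)) : FundamentalGroup (Surface ℓ) (vertex ℓ) :=
  (FundamentalGroup.fromPath (Path.Homotopic.Quotient.mk (sideLoop k)))⁻¹

theorem sideClass_pairedSide (k : Fin (4 * ℓ)) :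
    sideClass ⟨pairedSide k, pairedSide_lt k.2⟩ = (sideClass k)⁻¹ := by
  have hloop : sideLoop ⟨pairedSide k, pairedSide_lt k.2⟩ = (sideLoop k).symm := by
    ext t
    simpa [sideLoop_apply] using (toSurface_arc_pairedSide k.2 (unitInterval.symm t)).symm
  rw [sideClass, hloop, Path.Homotopic.Quotient.mk_symm]
  rfl

theorem sideClass_eq_boundaryLetter (k : Fin (4 * ℓ)) :
    sideClass k = boundaryLetter (genA ℓ) (genB ℓ) k := by
  obtain ⟨i, r, rfl⟩ := exists_eq_four_mul_add k
  have ha : sideClass ⟨4 * i, by omega⟩ = genA ℓ i := rfl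
  have hb : sideClass ⟨4 * i + 1, by omega⟩ = genB ℓ i := rfl
  have ha' := sideClass_pairedSide (ℓ := ℓ) ⟨4 * i, by omega⟩
  have hb' := sideClass_pairedSide (ℓ := ℓ) ⟨4 * i + 1, by omega⟩
  rw [boundaryLetter_four_mul_add]
  fin_cases r <;> simp_all [pairedSide, Nat.add_mod]

end SideClass

section Hom

variable {Q : Type*} [Group Q] {ℓ : ℕ} {w : ℕ → Q}

theorem Cover.mk_arc_zero (hw : IsBoundaryWord ℓ w) {k : ℕ} (hk : k ≤ 4 * ℓ) (q : Q) :
    Cover.mk ℓ w (arc ℓ k 0, q * (w k)⁻¹) = Cover.mk ℓ w (arc ℓ 0 0, q) := by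
  have hpaired : ∀ k < 4 * ℓ, Cover.mk ℓ w (arc ℓ k 0, q * (w k)⁻¹) =
      Cover.mk ℓ w (arc ℓ (pairedSide k + 1) 0, q * (w (pairedSide k + 1))⁻¹) := by
    intro k hk
    rw [← arc_one]
    exact Quot.sound (by simpa using LiftPairing.side (w := w) k hk 0 _ _ (by simp))
  simpa [hw.zero] using eq_zero_of_eq_pairedSide_succ hpaired hk

theorem IsBoundaryWord.exists_hom_sideClass_eq (hℓ : 0 < ℓ) (hw : IsBoundaryWord ℓ w) :
    ∃ φ : FundamentalGroup (Surface ℓ) (vertex ℓ) →* Q,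
      ∀ k : Fin (4 * ℓ), φ (sideClass k) = (w k)⁻¹ * w (k + 1) := by
  let _ : TopologicalSpace Q := ⊥
  have : DiscreteTopology Q := ⟨rfl⟩
  have hp := Cover.isQuotientCoveringMap_proj hℓ hw
  let e : Cover.proj (ℓ := ℓ) (w := w) ⁻¹' {vertex ℓ} := ⟨Cover.mk ℓ w (arc ℓ 0 0, 1), rfl⟩
  let ψ := hp.fundamentalGroupToMulOpposite e
  have hside : ∀ k : Fin (4 * ℓ),
      ψ (FundamentalGroup.fromPath (.mk (sideLoop k))) = MulOpposite.op ((w k)⁻¹ * w (k + 1)) := by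
    intro k
    rw [hp.fundamentalGroupToMulOpposite_apply_eq_Iff]
    -- The lift of the side starting at `e` runs along the side of the copy `(w k)⁻¹`.
    let Γ : Path e.1 (((w k)⁻¹ * w (k + 1)) • e.1) :=
      ((sidePath ℓ k).map (f := fun z => Cover.mk ℓ w (z, (w k)⁻¹))
        (Cover.isQuotientMap_mk.continuous.comp (by fun_prop))).cast
        (by simpa using (Cover.mk_arc_zero hw k.2.le 1).symm)
        (by simpa [e, Cover.smul_mk] using
          (Cover.mk_arc_zero hw (k := k + 1) k.2 ((w k)⁻¹ * w (k + 1))).symm)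
    exact congrArg Subtype.val (hp.isCoveringMap.monodromy_eq_of_map_eq (γ := .mk (sideLoop k))
      (ey := ⟨((w k)⁻¹ * w (k + 1)) • e.1, rfl⟩) (.mk Γ) rfl).symm
  refine ⟨(MulEquiv.inv' Q).symm.toMonoidHom.comp ψ, fun k => ?_⟩
  rw [sideClass, map_inv, MonoidHom.comp_apply, hside]
  simp

/-- The product of the first `k` letters of a word of length `n`, extended periodically. -/
def initialProd {n : ℕ} (s : Fin n → Q) (k : ℕ) : Q := ((List.ofFn s).take (k % n)).prod

theorem initialProd_succ {n : ℕ} {s : Fin n → Q} (hs : (List.ofFn s).prod = 1) (k : Fin n) :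
    initialProd s (k + 1) = initialProd s k * s k := by
  have hk : initialProd s k * s k = ((List.ofFn s).take (k + 1)).prod := by
    rw [initialProd, Nat.mod_eq_of_lt k.2, prod_take_ofFn_succ]
  rw [hk, initialProd]
  rcases (Nat.succ_le_of_lt k.2).eq_or_lt with hlast | hlt
  · have hlast : (k : ℕ) + 1 = n := hlast
    rw [hlast, Nat.mod_self, List.take_zero, List.prod_nil,
      List.take_of_length_le List.length_ofFn.le, hs]
  · rw [Nat.mod_eq_of_lt hlt]

theorem isBoundaryWord_initialProd {s : Fin (4 * ℓ) → Q} (hs : (List.ofFn s).prod = 1)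
    (hinv : ∀ k : Fin (4 * ℓ), s ⟨pairedSide k, pairedSide_lt k.2⟩ = (s k)⁻¹) :
    IsBoundaryWord ℓ (initialProd s) where
  zero := by simp [initialProd]
  periodic k := by simp [initialProd]
  inv_mul_succ k hk := by
    have hk' := initialProd_succ hs ⟨k, hk⟩
    have hp := initialProd_succ hs ⟨pairedSide k, pairedSide_lt hk⟩
    simp only at hk' hp
    rw [hk', hp, hinv ⟨k, hk⟩]
    group

theorem exists_hom_of_prod_commutator_eq_one (hℓ : 0 < ℓ) (A B : Fin ℓ → Q)
    (h : (List.ofFn fun i => ⁅A i, B i⁆).prod = 1) :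
    ∃ φ : FundamentalGroup (Surface ℓ) (vertex ℓ) →* Q,
      (∀ i, φ (genA ℓ i) = A i) ∧ ∀ i, φ (genB ℓ i) = B i := by
  have hs : (List.ofFn (boundaryLetter A B)).prod = 1 := (prod_ofFn_boundaryLetter A B).trans h
  obtain ⟨φ, hφ⟩ := (isBoundaryWord_initialProd hs
    (boundaryLetter_pairedSide A B)).exists_hom_sideClass_eq hℓ
  have hside : ∀ k, φ (sideClass k) = boundaryLetter A B k := fun k => by
    rw [hφ, initialProd_succ hs, inv_mul_cancel_left]
  exact ⟨φ, fun i => (hside ⟨4 * i, by omega⟩).trans (boundaryLetter_four_mul_add A B i 0),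
    fun i => (hside ⟨4 * i + 1, by omega⟩).trans (boundaryLetter_four_mul_add A B i 1)⟩

end Hom

section Relation

variable {X Y : Type*} [TopologicalSpace X] [TopologicalSpace Y] {f : C(Y, X)} {x : X}
  {g h : FundamentalGroup X x} {z z' z'' : Y}

/-- `g⁻¹` is the class of a loop which is the image under `f` of a path from `z` to `z'`; the
inverse makes the multiplication agree with concatenation of paths. -/
def IsPathClass (f : C(Y, X)) (g : FundamentalGroup X x) (z z' : Y) : Prop :=
  ∃ (p : Path z z') (hz : x = f z) (hz' : x = f z'),
    g⁻¹ = FundamentalGroup.fromPath (.mk ((p.map f.continuous).cast hz hz'))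

namespace IsPathClass

theorem one (hz : x = f z) : IsPathClass f (1 : FundamentalGroup X x) z z := by
  subst hz
  exact ⟨Path.refl z, rfl, rfl, inv_one⟩

theorem mul (hg : IsPathClass f g z z') (hh : IsPathClass f h z' z'') :
    IsPathClass f (g * h) z z'' := by
  obtain ⟨p, hz, hz', hg⟩ := hg
  obtain ⟨q, _, hz'', hh⟩ := hh
  subst hz
  refine ⟨p.trans q, rfl, hz'', ?_⟩
  rw [mul_inv_rev, hg, hh, FundamentalGroup.mul_def]
  refine (Path.Homotopic.Quotient.mk_trans _ _).symm.trans ?_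
  rw [Path.map_trans]
  rfl

theorem eq_one [SimplyConnectedSpace Y] (hg : IsPathClass f g z z) : g = 1 := by
  obtain ⟨p, rfl, _, hg⟩ := hg
  have hp : p.Homotopic (Path.refl z) := SimplyConnectedSpace.paths_homotopic p (Path.refl z)
  rw [← inv_eq_one, hg]
  exact Path.Homotopic.Quotient.eq.2 (hp.map f)

theorem prod_take_ofFn {n : ℕ} {s : Fin n → FundamentalGroup X x} {v : ℕ → Y} (h0 : x = f (v 0))
    (hs : ∀ k : Fin n, IsPathClass f (s k) (v k) (v (k + 1))) {k : ℕ} (hk : k ≤ n) :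
    IsPathClass f ((List.ofFn s).take k).prod (v 0) (v k) := by
  induction k with
  | zero => exact one h0
  | succ k ih =>
    rw [prod_take_ofFn_succ s ⟨k, hk⟩]
    exact (ih (by omega)).mul (hs ⟨k, hk⟩)

end IsPathClass

variable {ℓ : ℕ}

instance : ContractibleSpace Disc :=
  (convex_closedBall (0 : ℂ) 1).contractibleSpace ⟨0, by simp⟩

theorem isPathClass_sideClass (k : Fin (4 * ℓ)) :
    IsPathClass ⟨toSurface ℓ, continuous_toSurface ℓ⟩ (sideClass k) (arc ℓ k 0)
      (arc ℓ (k + 1) 0) :=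
  ⟨sidePath ℓ k, (toSurface_arc_eq_vertex k.2.le).symm, (toSurface_arc_eq_vertex k.2).symm,
    inv_inv _⟩

theorem arc_four_mul_self (hℓ : 0 < ℓ) : arc ℓ (4 * ℓ) 0 = arc ℓ 0 0 := by
  have : (ℓ : ℂ) ≠ 0 := by exact_mod_cast hℓ.ne'
  apply Subtype.ext
  simp [arc, this, Complex.exp_two_pi_mul_I]

theorem prod_commutator_gen (hℓ : 0 < ℓ) : (List.ofFn fun i => ⁅genA ℓ i, genB ℓ i⁆).prod = 1 := by
  have h := IsPathClass.prod_take_ofFn (x := vertex ℓ) (v := fun k => arc ℓ k 0) rfl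
    isPathClass_sideClass le_rfl
  rw [List.take_of_length_le List.length_ofFn.le, arc_four_mul_self hℓ] at h
  rw [← prod_ofFn_boundaryLetter, ← funext sideClass_eq_boundaryLetter]
  exact h.eq_one

theorem prod_commutator_map_gen (hℓ : 0 < ℓ) {H : Type*} [Group H]
    (F : FundamentalGroup (Surface ℓ) (vertex ℓ) →* H) :
    (List.ofFn fun i => ⁅F (genA ℓ i), F (genB ℓ i)⁆).prod = 1 := by
  rw [← map_prod_ofFn_commutator, prod_commutator_gen hℓ, map_one]

instance : PathConnectedSpace (Surface ℓ) :=
  (Quot.mk_surjective (r := SidePairing ℓ)).pathConnectedSpace (continuous_toSurface ℓ)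

theorem mapOfEq_symm_map (e : X ≃ₜ Y) (g : FundamentalGroup X x) :
    FundamentalGroup.mapOfEq (e.symm : C(Y, X)) (e.symm_apply_apply x)
      (FundamentalGroup.map (e : C(X, Y)) x g) = g := by
  induction g using Path.Homotopic.Quotient.ind with
  | mk γ =>
    refine (FundamentalGroup.mapOfEq_apply _ _ _).trans (congrArg Path.Homotopic.Quotient.mk ?_)
    ext t
    exact e.symm_apply_apply (γ t)

end Relation

theorem exists_hom_twisted_sum_area_eq_one {ℓ : ℕ} (hℓ : 0 < ℓ) {C : Type*} [Group C]
    {a b : Fin ℓ → C} {c : Subgroup.center C}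
    (h : (List.ofFn fun i => ⁅a i, b i⁆).prod * (c : C) = 1) :
    ∃ φ : FundamentalGroup (Surface ℓ) (vertex ℓ) →* Twisted C c,
      ∑ i, Twisted.area (φ (genA ℓ i)) (φ (genB ℓ i)) = 1 := by
  let χ : Fin ℓ → ℤ := Pi.single ⟨0, hℓ⟩ 1
  let p : Fin ℓ → Twisted C c := fun i => ⟨a i, χ i, 0⟩
  let q : Fin ℓ → Twisted C c := fun i => ⟨b i, 0, χ i⟩
  have harea : ∑ i, Twisted.area (p i) (q i) = 1 := by
    simp [Twisted.area, p, q, χ, Pi.single_apply]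
  have hpq : (List.ofFn fun i => ⁅p i, q i⁆).prod = 1 := by
    rw [Twisted.prod_commutator_eq, harea, zpow_one, h, map_one]
  obtain ⟨φ, hA, hB⟩ := exists_hom_of_prod_commutator_eq_one hℓ p q hpq
  exact ⟨φ, by simpa only [hA, hB] using harea⟩

end

end SurfaceScl

/-- Let `X` be a closed connected oriented surface of genus `ℓ ≥ 2`, i.e. a space homeomorphic to
the standard surface of genus `ℓ`. For every base point, `scl_G` and `scl_{G,G'}` are not
equivalent on `[G, G']`, where `G` is the fundamental group of `X`; and the explicit sequence `x_n`
lies in `[G, G']`, has bounded `scl_G`, and has `scl_{G,G'}` tending to infinity. -/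
theorem theorem1p1 (ℓ : ℕ) (hℓ : 2 ≤ ℓ) {X : Type*} [TopologicalSpace X]
    (e : SurfaceScl.Surface ℓ ≃ₜ X) :
    (∀ p : X, ¬ SurfaceScl.SclEquivalent (commutator (FundamentalGroup X p))) ∧
    (∀ n : ℕ, SurfaceScl.surfaceWitness e n ∈
      ⁅(⊤ : Subgroup (FundamentalGroup X (e (SurfaceScl.vertex ℓ)))),
        commutator (FundamentalGroup X (e (SurfaceScl.vertex ℓ)))⁆) ∧
    BddAbove (Set.range fun n : ℕ => SurfaceScl.scl (SurfaceScl.surfaceWitness e n)) ∧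
    Filter.Tendsto
      (fun n : ℕ => SurfaceScl.mixedScl
        (commutator (FundamentalGroup X (e (SurfaceScl.vertex ℓ))))
        (SurfaceScl.surfaceWitness e n))
      Filter.atTop Filter.atTop := by
  have hpos : 0 < ℓ := by omega
  let F := FundamentalGroup.map (e : C(SurfaceScl.Surface ℓ, X)) (SurfaceScl.vertex ℓ)
  let E := FundamentalGroup.mapOfEq (e.symm : C(X, SurfaceScl.Surface ℓ))
    (e.symm_apply_apply (SurfaceScl.vertex ℓ))
  have hmem : ∀ n, SurfaceScl.surfaceWitness e n ∈ _ :=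
    SurfaceScl.witness_mem (SurfaceScl.prod_commutator_map_gen hpos F)
  have hbdd : BddAbove (Set.range fun n => SurfaceScl.scl (SurfaceScl.surfaceWitness e n)) :=
    ⟨ℓ, Set.forall_mem_range.2 (SurfaceScl.scl_witness_le _ _)⟩
  obtain ⟨a, b, c, habc, hc⟩ := SurfaceScl.exists_prod_commutator_mul_center_eq_one hℓ
  obtain ⟨φ, hφ⟩ := SurfaceScl.exists_hom_twisted_sum_area_eq_one hpos habc
  have harea : ∑ i, SurfaceScl.Twisted.area (φ.comp E (F (SurfaceScl.genA ℓ i)))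
      (φ.comp E (F (SurfaceScl.genB ℓ i))) ≠ 0 := by
    simp only [MonoidHom.comp_apply, E, F, SurfaceScl.mapOfEq_symm_map, hφ]
    exact one_ne_zero
  have hlim := SurfaceScl.tendsto_mixedScl_witness
    SurfaceScl.isInvariantQuasimorphismOn_translationNumber hc (φ.comp E)
    (SurfaceScl.prod_commutator_map_gen hpos F) harea
  refine ⟨fun p hp => ?_, hmem, hbdd, hlim⟩
  have : PathConnectedSpace X := e.surjective.pathConnectedSpace e.continuous
  exact SurfaceScl.not_sclEquivalent_of_tendsto hmem hbdd hlim (hp.of_mulEquiv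
    (FundamentalGroup.fundamentalGroupMulEquivOfPathConnected (e (SurfaceScl.vertex ℓ)) p))
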